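/- Let $\Bbbk$ be a field and let $H$ be a Hopf algebra over $\Bbbk$ with coproduct $h\mapsto h_{(1)}\otimes h_{(2)}$, counit $\epsilon$ and antipode $S$. A quasi-Yetter–Drinfeld (quasi-YD) module over $H$ is a left $H$-module $V$ with a linear map (quasicoaction) $\delta\colon V\to H\otimes V$, $\delta(v)=v^{[-1]}\otimes v^{[0]}$, such that $$(h_{(1)}\triangleright v)^{[-1]}h_{(2)}\otimes(h_{(1)}\triangleright v)^{[0]}=h_{(1)}v^{[-1]}\otimes h_{(2)}\triangleright v^{[0]}\qquad(h\in H,\ v\in V).$$ It is a Yetter–Drinfeld (YD) module if moreover $\delta$ is a (coassociative, counital) coaction. For a quasi-YD module $(V,\delta)$ let $\widetilde A(V,\delta)$ be the algebra generated by the space $V$, the algebra $H$ and the space $V^*$ with relations $hv=(h_{(1)}\triangleright v)h_{(2)}$, $fh=h_{(1)}(f\triangleleft h_{(2)})$, $fv-vf=v^{[-1]}\langle f,v^{[0]}\rangle$, where $\langle f\triangleleft h,v\rangle=\langle f,h\triangleright v\rangle$. A triangular ideal is a two-sided ideal of the form $I^-\,H\,T(V^*)+T(V)\,H\,I^+$ with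 subspaces $I^-\subseteq T^{>0}(V)$, $I^+\subseteq T^{>0}(V^*)$. Let $I(V,\delta)\subseteq T(V)$ be the component $I^-$ of the largest triangular ideal (the sum of all triangular ideals). Let $(V,\delta_V)$, $(W,\delta_W)$ be quasi-YD modules. $V$ is a subquotient of $W$ via $V\xrightarrow{\mu}W\xrightarrow{\nu}V$ if $\mu,\nu$ are $H$-module maps and $\delta_V=(\mathrm{id}_H\otimes\nu)\circ\delta_W\circ\mu$; it is a perfect subquotient if, in addition, $I(V,\delta_V)=T(\mu)^{-1}I(W,\delta_W)$, where $T(\mu)\colon T(V)\to T(W)$ is the algebra map induced by $\mu$. **Theorem.** Let $(V,\delta)$ be a quasi-YD module over $H$. 1. The space $Y(V)=H\otimes V$ with action $h\triangleright(x\otimes v)=h_{(1)}\,x\,S(h_{(3)})\otimes h_{(2)}\triangleright v$ and coaction $x\otimes v\mapsto x_{(1)}\otimes x_{(2)}\otimes v$ is a YD module over $H$, and $V$ is a perfect subquotient of $Y(V)$ via the maps $V\xrightarrow{\ \delta\ }Y(V)\xrightarrow{\ \epsilon\otimes\mathrm{id}_V\ }V$. 2. If $V$ is finite-dimensional and either $\dim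 H<\infty$ or $H$ is commutative and cocommutative, then there is a finite-dimensional YD module $Y$ over $H$ such that $V$ is a perfect subquotient of $Y$ (via some maps $V\to Y\to V$). -/

import Mathlib

open scoped TensorProduct

universe u v w w'

noncomputable section

namespace BraidedDoubles

/-- The raw data on a vector space `V`: a linear map `H → End V` (the candidate left action
`h ▷ v = act h v`) and a linear map `δ : V → H ⊗ V` (a quasicoaction). The axioms are imposed in
`IsQuasiYD` and `IsYD`. -/
structure ActionCoaction (k : Type u) (H : Type v) (V : Type w) [Field k] [Ring H]
    [HopfAlgebra k H] [AddCommGroup V] [Module k V] where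
  /-- the action -/
  act : H →ₗ[k] Module.End k V
  /-- the quasicoaction -/
  coact : V →ₗ[k] H ⊗[k] V

variable {k : Type u} {H : Type v} {V : Type w} {W : Type w'} [Field k] [Ring H] [HopfAlgebra k H]
  [AddCommGroup V] [Module k V] [AddCommGroup W] [Module k W]

namespace ActionCoaction

/-- For fixed `v`, the map `a ⊗ b ↦ (a ▷ v)^[-1] b ⊗ (a ▷ v)^[0]`. -/
def compatLeft (S : ActionCoaction k H V) (x : V) : H ⊗[k] H →ₗ[k] H ⊗[k] V :=
  TensorProduct.lift <| LinearMap.mk₂ k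
    (fun a b => (LinearMap.mulRight k b).rTensor V (S.coact (S.act a x)))
    (by intros; simp) (by intros; simp)
    (by
      intro a b b'
      have h : LinearMap.mulRight k (b + b') = LinearMap.mulRight k b + LinearMap.mulRight k b' := by
        ext; simp [mul_add]
      rw [h, LinearMap.rTensor_add, LinearMap.add_apply])
    (by
      intro c a b
      have h : LinearMap.mulRight k (c • b) = c • LinearMap.mulRight k b := by
        ext; simp
      rw [h, LinearMap.rTensor_smul, LinearMap.smul_apply])

/-- For fixed `v`, the map `a ⊗ b ↦ a v^[-1] ⊗ b ▷ v^[0]`. -/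
def compatRight (S : ActionCoaction k H V) (x : V) : H ⊗[k] H →ₗ[k] H ⊗[k] V :=
  TensorProduct.lift <| LinearMap.mk₂ k
    (fun a b => TensorProduct.map (LinearMap.mulLeft k a) (S.act b) (S.coact x))
    (by
      intro a a' b
      have h : LinearMap.mulLeft k (a + a') = LinearMap.mulLeft k a + LinearMap.mulLeft k a' := by
        ext; simp [add_mul]
      rw [h, TensorProduct.map_add_left, LinearMap.add_apply])
    (by
      intro c a b
      have h : LinearMap.mulLeft k (c • a) = c • LinearMap.mulLeft k a := by
        ext; simp
      rw [h, TensorProduct.map_smul_left, LinearMap.smul_apply])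
    (by intros; rw [map_add, TensorProduct.map_add_right, LinearMap.add_apply])
    (by intros; rw [map_smul, TensorProduct.map_smul_right, LinearMap.smul_apply])

/-- Quasi-Yetter–Drinfeld modules: `V` is a left `H`-module and
`(h₁ ▷ v)^[-1] h₂ ⊗ (h₁ ▷ v)^[0] = h₁ v^[-1] ⊗ h₂ ▷ v^[0]`. -/
structure IsQuasiYD (S : ActionCoaction k H V) : Prop where
  act_one : S.act 1 = 1
  act_mul : ∀ g h : H, S.act (g * h) = S.act g * S.act h
  compat : ∀ (h : H) (x : V),
    S.compatLeft x (Coalgebra.comul (R := k) h) = S.compatRight x (Coalgebra.comul (R := k) h)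

/-- Yetter–Drinfeld modules: quasi-Yetter–Drinfeld modules whose quasicoaction is a coaction. -/
structure IsYD (S : ActionCoaction k H V) : Prop extends IsQuasiYD S where
  coassoc : ∀ x : V,
    TensorProduct.assoc k H H V ((Coalgebra.comul (R := k) (A := H)).rTensor V (S.coact x)) =
      S.coact.lTensor H (S.coact x)
  counit : ∀ x : V,
    TensorProduct.lid k V ((Coalgebra.counit (R := k) (A := H)).rTensor V (S.coact x)) = x

/-! ### The free braided double -/

/-- The bilinear pairing `β(f, v) = v^[-1] ⟨f, v^[0]⟩` with values in `H`. -/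
def pairing (S : ActionCoaction k H V) (f : Module.Dual k V) (x : V) : H :=
  TensorProduct.rid k H (f.lTensor H (S.coact x))

/-- The right action `f ◁ h` of `H` on the dual space, `⟨f ◁ h, v⟩ = ⟨f, h ▷ v⟩`, as a linear
map in `h`. -/
def dualAct (S : ActionCoaction k H V) (f : Module.Dual k V) : H →ₗ[k] Module.Dual k V :=
  LinearMap.compRight k f ∘ₗ S.act

end ActionCoaction

variable (k H V) in
/-- The free algebra on the space of generators `V ⊕ H ⊕ V^*`. -/
abbrev Gens : Type max u v w := TensorAlgebra k (V × H × Module.Dual k V)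

variable (k H V) in
/-- The generators from `V`. -/
def genV : V →ₗ[k] Gens k H V :=
  TensorAlgebra.ι k ∘ₗ LinearMap.inl k V (H × Module.Dual k V)

variable (k H V) in
/-- The generators from `H`. -/
def genH : H →ₗ[k] Gens k H V :=
  TensorAlgebra.ι k ∘ₗ LinearMap.inr k V (H × Module.Dual k V) ∘ₗ
    LinearMap.inl k H (Module.Dual k V)

variable (k H V) in
/-- The generators from `V^*`. -/
def genD : Module.Dual k V →ₗ[k] Gens k H V :=
  TensorAlgebra.ι k ∘ₗ LinearMap.inr k V (H × Module.Dual k V) ∘ₗ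
    LinearMap.inr k H (Module.Dual k V)

namespace ActionCoaction

/-- The defining relations of the free braided double: those of the algebra `H`, and
`h v = (h₁ ▷ v) h₂`, `f h = h₁ (f ◁ h₂)`, `f v - v f = v^[-1] ⟨f, v^[0]⟩`. -/
inductive Rel (S : ActionCoaction k H V) : Gens k H V → Gens k H V → Prop
  | one : Rel S (genH k H V 1) 1
  | mul (g h : H) : Rel S (genH k H V g * genH k H V h) (genH k H V (g * h))
  | act (h : H) (x : V) : Rel S (genH k H V h * genV k H V x)
      (LinearMap.mul' k (Gens k H V)
        (TensorProduct.map (genV k H V ∘ₗ S.act.flip x) (genH k H V)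
          (Coalgebra.comul (R := k) h)))
  | dualAct (f : Module.Dual k V) (h : H) : Rel S (genD k H V f * genH k H V h)
      (LinearMap.mul' k (Gens k H V)
        (TensorProduct.map (genH k H V) (genD k H V ∘ₗ S.dualAct f)
          (Coalgebra.comul (R := k) h)))
  | comm (f : Module.Dual k V) (x : V) :
      Rel S (genD k H V f * genV k H V x - genV k H V x * genD k H V f)
        (genH k H V (S.pairing f x))

/-- The free braided double `Ã(V, δ)`. -/
abbrev FreeDouble (S : ActionCoaction k H V) : Type max u v w := RingQuot S.Rel

/-- The canonical algebra map `T(V) → Ã(V, δ)`. -/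
def lower (S : ActionCoaction k H V) : TensorAlgebra k V →ₐ[k] S.FreeDouble :=
  TensorAlgebra.lift k ((RingQuot.mkAlgHom k S.Rel).toLinearMap ∘ₗ genV k H V)

/-- The canonical map `H → Ã(V, δ)`. -/
def middle (S : ActionCoaction k H V) : H →ₗ[k] S.FreeDouble :=
  (RingQuot.mkAlgHom k S.Rel).toLinearMap ∘ₗ genH k H V

/-- The canonical algebra map `T(V^*) → Ã(V, δ)`. -/
def upper (S : ActionCoaction k H V) : TensorAlgebra k (Module.Dual k V) →ₐ[k] S.FreeDouble :=
  TensorAlgebra.lift k ((RingQuot.mkAlgHom k S.Rel).toLinearMap ∘ₗ genD k H V)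

end ActionCoaction

variable (k) in
/-- `T^{>0}(V)`, the kernel of the augmentation `T(V) → k` that kills `V`. -/
def positivePart (V : Type w) [AddCommGroup V] [Module k V] : Submodule k (TensorAlgebra k V) :=
  LinearMap.ker (TensorAlgebra.algebraMapInv (R := k) (M := V)).toLinearMap

namespace ActionCoaction

/-- The subspace `I⁻ H T(V^*) + T(V) H I⁺` of `Ã(V, δ)`. -/
def triangularSpan (S : ActionCoaction k H V) (Im : Submodule k (TensorAlgebra k V))
    (Ip : Submodule k (TensorAlgebra k (Module.Dual k V))) : Submodule k S.FreeDouble :=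
  Im.map S.lower.toLinearMap * LinearMap.range S.middle * LinearMap.range S.upper.toLinearMap ⊔
    LinearMap.range S.lower.toLinearMap * LinearMap.range S.middle * Ip.map S.upper.toLinearMap

/-- The pair of subspaces `I⁻ ⊆ T^{>0}(V)`, `I⁺ ⊆ T^{>0}(V^*)` defines a triangular ideal, that is,
`I⁻ H T(V^*) + T(V) H I⁺` is a two-sided ideal of `Ã(V, δ)`. -/
structure IsTriangular (S : ActionCoaction k H V) (Im : Submodule k (TensorAlgebra k V))
    (Ip : Submodule k (TensorAlgebra k (Module.Dual k V))) : Prop where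
  lower_le : Im ≤ positivePart k V
  upper_le : Ip ≤ positivePart k (Module.Dual k V)
  mul_left_mem : ∀ a b : S.FreeDouble, b ∈ S.triangularSpan Im Ip → a * b ∈ S.triangularSpan Im Ip
  mul_right_mem : ∀ a b : S.FreeDouble, b ∈ S.triangularSpan Im Ip → b * a ∈ S.triangularSpan Im Ip

/-- `I(V, δ) ⊆ T(V)`: the lower component of the largest triangular ideal (the sum of all
triangular ideals) of `Ã(V, δ)`. -/
def lowerIdeal (S : ActionCoaction k H V) : Submodule k (TensorAlgebra k V) :=
  sSup {Im | ∃ Ip, S.IsTriangular Im Ip}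

end ActionCoaction

/-! ### Perfect subquotients -/

/-- `V` is a subquotient of `W` via `V --μ--> W --ν--> V`: both maps are maps of `H`-modules and
`δ_V = (id_H ⊗ ν) ∘ δ_W ∘ μ`. -/
structure IsSubquotient (S : ActionCoaction k H V) (T : ActionCoaction k H W)
    (μ : V →ₗ[k] W) (ν : W →ₗ[k] V) : Prop where
  map_act_left : ∀ (h : H) (x : V), μ (S.act h x) = T.act h (μ x)
  map_act_right : ∀ (h : H) (y : W), ν (T.act h y) = S.act h (ν y)
  coact_eq : S.coact = ν.lTensor H ∘ₗ T.coact ∘ₗ μ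

/-- `V` is a perfect subquotient of `W` via `V --μ--> W --ν--> V`: it is a subquotient and
`I(V, δ_V) = T(μ)⁻¹ I(W, δ_W)`. -/
structure IsPerfectSubquotient (S : ActionCoaction k H V) (T : ActionCoaction k H W)
    (μ : V →ₗ[k] W) (ν : W →ₗ[k] V) : Prop extends IsSubquotient S T μ ν where
  lowerIdeal_eq : S.lowerIdeal =
    T.lowerIdeal.comap (TensorAlgebra.lift k (TensorAlgebra.ι k ∘ₗ μ)).toLinearMap

/-! ### The Yetter–Drinfeld module `Y(V) = H ⊗ V` -/

variable (k H) in
/-- The bilinear map sending `(a, c)` to the operator `x ↦ a x S(c)` on `H`. -/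
def twoSidedMul : H →ₗ[k] H →ₗ[k] Module.End k H :=
  LinearMap.mk₂ k
    (fun a c => LinearMap.mulLeft k a ∘ₗ LinearMap.mulRight k (HopfAlgebra.antipode k c))
    (by intros; ext; simp [add_mul]) (by intros; ext; simp)
    (by intros; ext; simp [mul_add]) (by intros; ext; simp)

variable (k H) in
/-- The map `h ↦ (h₁ ⊗ h₃) ⊗ h₂`. -/
def comulOuterInner : H →ₗ[k] (H ⊗[k] H) ⊗[k] H :=
  (TensorProduct.assoc k H H H).symm.toLinearMap ∘ₗ
    (TensorProduct.comm k H H).toLinearMap.lTensor H ∘ₗ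
      (Coalgebra.comul (R := k) (A := H)).lTensor H ∘ₗ Coalgebra.comul (R := k) (A := H)

/-- `Y(V) = H ⊗ V`, with `h ▷ (x ⊗ v) = h₁ x S(h₃) ⊗ h₂ ▷ v` and
`x ⊗ v ↦ x₁ ⊗ (x₂ ⊗ v)`. -/
def ActionCoaction.Y (S : ActionCoaction k H V) : ActionCoaction k H (H ⊗[k] V) where
  act := TensorProduct.homTensorHomMap (RingHom.id k) H V H V ∘ₗ
    TensorProduct.map (TensorProduct.lift (twoSidedMul k H)) S.act ∘ₗ comulOuterInner k H
  coact := (TensorProduct.assoc k H H V).toLinearMap ∘ₗ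
    (Coalgebra.comul (R := k) (A := H)).rTensor V

variable (k H V) in
/-- The map `ε ⊗ id_V : H ⊗ V → V`. -/
def counitTensor : H ⊗[k] V →ₗ[k] V :=
  (TensorProduct.lid k V).toLinearMap ∘ₗ (Coalgebra.counit (R := k) (A := H)).rTensor V

end BraidedDoubles

end

/-!
The ideal `I(V, δ)` is the largest subspace `I` of `T^{>0}(V)` that is stable, in the sense that
`[f, I] ⊆ I ⊗ H` for all `f ∈ V^*`: the free braided double acts on `T(V) ⊗ H`, which shows that the
lower part of a triangular ideal is stable, and a stable subspace generates a triangular ideal with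
`I⁺ = 0`. Stable subspaces pull back along `T(μ)` for every subquotient `V → W → V`. They push
forward if `δ_W ∘ μ = (id ⊗ τ) ∘ δ_{Y(V)} ∘ δ_V` for some linear `τ : Y(V) → W`, because `[g, -]`
then restricts along `T(μ)` to a combination of the `[f, -]`, up to maps `h ↦ h₁ γ(h₂)` of `H`; so a
subquotient of this kind is perfect. The quasi-Yetter–Drinfeld condition says that `δ : V → Y(V)` is
`H`-linear, which makes `Y(V)` itself, with `τ = id`, such a subquotient. If `H` is commutative and
cocommutative, then `H` acts on `Y(V)` through the second factor alone, so `C ⊗ V ⊆ Y(V)` is a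
Yetter–Drinfeld submodule for every coideal `C` of `H`, and some finite-dimensional `C` satisfies
`δ(V) ⊆ C ⊗ V`.
-/

noncomputable section

namespace BraidedDoubles

open Coalgebra WithConv TensorProduct MulOpposite

section Convolution

variable {R : Type*} [CommSemiring R] {A : Type*} [Semiring A] [Algebra R A]
  {B : Type*} [Semiring B] [Algebra R B]

section Coalgebra

variable {C : Type*} [AddCommMonoid C] [Module R C] [Coalgebra R C]

lemma sum_smul_counit {ι : Type*} {c : C} (r : Repr R c ι) :
    ∑ i ∈ r.index, counit (R := R) (r.right i) • r.left i = c := by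
  simpa only [map_sum, TensorProduct.rid_tmul, one_smul] using
    congrArg (TensorProduct.rid R C) (sum_tmul_counit_eq (R := R) r)

variable (R C) in
/-- The embedding of an algebra `A` into the convolution algebra `Hom(C, A)`, which sends `a` to
`c ↦ ε(c) a`. -/
def convConst : A →ₐ[R] WithConv (C →ₗ[R] A) :=
  AlgHom.ofLinearMap ((WithConv.linearEquiv R _).symm.toLinearMap ∘ₗ
      LinearMap.smulRightₗ (counit (R := R) (A := C)))
    (by ext c; simp [Algebra.algebraMap_eq_smul_one])
    fun a b => by
      ext c
      rw [(ℛ R c).convMul_apply]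
      conv_lhs => rw [← sum_counit_smul (R := R) (ℛ R c)]
      simp [smul_comm (counit ((ℛ R c).left _)) (counit ((ℛ R c).right _))]

@[simp] lemma convConst_apply (a : A) (c : C) : convConst R C a c = counit (R := R) c • a := rfl

lemma convMul_convConst_apply (φ : WithConv (C →ₗ[R] A)) (a : A) (c : C) :
    (φ * convConst R C a) c = φ c * a := by
  rw [(ℛ R c).convMul_apply]
  conv_rhs => rw [← sum_smul_counit (ℛ R c)]
  simp [Finset.sum_mul]

lemma convConst_convMul_apply (a : A) (φ : WithConv (C →ₗ[R] A)) (c : C) :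
    (convConst R C a * φ) c = a * φ c := by
  rw [(ℛ R c).convMul_apply]
  conv_rhs => rw [← sum_counit_smul (R := R) (ℛ R c)]
  simp [Finset.mul_sum]

lemma convMul_apply_mem {p : Submodule R A} {φ ψ : WithConv (C →ₗ[R] A)}
    (h : ∀ c d, φ c * ψ d ∈ p) (c : C) : (φ * ψ) c ∈ p := by
  rw [(ℛ R c).convMul_apply]
  exact Submodule.sum_mem _ fun i _ => h _ _

/-- The algebra map between convolution algebras given by composition with an algebra map. -/
def convPost (l : A →ₐ[R] B) : WithConv (C →ₗ[R] A) →ₐ[R] WithConv (C →ₗ[R] B) :=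
  AlgHom.ofLinearMap
    ((WithConv.linearEquiv R _).symm.toLinearMap ∘ₗ LinearMap.compRight R l.toLinearMap ∘ₗ
      (WithConv.linearEquiv R _).toLinearMap)
    (by ext c; simp)
    fun φ ψ => WithConv.ext (LinearMap.algHom_comp_convMul_distrib l φ ψ)

lemma convPost_apply (l : A →ₐ[R] B) (φ : WithConv (C →ₗ[R] A)) (c : C) :
    convPost l φ c = l (φ c) := rfl

end Coalgebra

lemma convMul_apply_mul {C : Type*} [Semiring C] [Bialgebra R C] (φ ψ : WithConv (C →ₗ[R] A))
    {c d : C} {ι κ : Type*} (r : Repr R c ι) (s : Repr R d κ) :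
    (φ * ψ) (c * d) = ∑ i ∈ r.index, ∑ j ∈ s.index,
      φ (r.left i * s.left j) * ψ (r.right i * s.right j) := by
  rw [LinearMap.convMul_apply, Bialgebra.comul_mul, ← r.eq, ← s.eq]
  simp [Finset.sum_mul_sum]

section HopfAlgebra

variable {C : Type*} [Semiring C] [HopfAlgebra R C]

lemma conv_mul_antipode (a : C →ₐ[R] A) :
    toConv a.toLinearMap * toConv (a.toLinearMap ∘ₗ HopfAlgebra.antipode R) =
      (1 : WithConv (C →ₗ[R] A)) := by
  have h := congrArg (convPost a) (LinearMap.id_mul_antipode (R := R) (C := C))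
  rwa [map_mul, map_one] at h

lemma conv_antipode_mul (a : C →ₐ[R] A) :
    toConv (a.toLinearMap ∘ₗ HopfAlgebra.antipode R) * toConv a.toLinearMap =
      (1 : WithConv (C →ₗ[R] A)) := by
  have h := congrArg (convPost a) (LinearMap.antipode_mul_id (R := R) (C := C))
  rwa [map_mul, map_one] at h

end HopfAlgebra

end Convolution

section Derivation

variable {R : Type*} [CommSemiring R] {M : Type*} [AddCommMonoid M] [Module R M]
  {A : Type*} [Semiring A] [Algebra R A] (l : TensorAlgebra R M →ₐ[R] A)

/-- The algebra map `t ↦ (l t, d t)` into the trivial square zero extension of `A`, where `d` is the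
derivation along `l` that extends `g : M → A`. -/
def derivationLift (g : M →ₗ[R] A) : TensorAlgebra R M →ₐ[R] TrivSqZeroExt A A :=
  TensorAlgebra.lift R
    (((TrivSqZeroExt.inlAlgHom R A A).comp l).toLinearMap ∘ₗ TensorAlgebra.ι R +
      (TrivSqZeroExt.inrHom A A).restrictScalars R ∘ₗ g)

lemma fst_derivationLift (g : M →ₗ[R] A) (t : TensorAlgebra R M) :
    (derivationLift l g t).fst = l t := by
  have h : (TrivSqZeroExt.fstHom R A A).comp (derivationLift l g) = l := by
    ext x
    simp [derivationLift]
  exact DFunLike.congr_fun h t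

lemma snd_derivationLift_ι (g : M →ₗ[R] A) (x : M) :
    (derivationLift l g (TensorAlgebra.ι R x)).snd = g x := by
  simp [derivationLift]

lemma snd_derivationLift_algebraMap (g : M →ₗ[R] A) (r : R) :
    (derivationLift l g (algebraMap R _ r)).snd = 0 := by
  rw [AlgHom.commutes, TrivSqZeroExt.algebraMap_eq_inl', TrivSqZeroExt.snd_inl]

lemma snd_derivationLift_mul (g : M →ₗ[R] A) (s t : TensorAlgebra R M) :
    (derivationLift l g (s * t)).snd =
      (derivationLift l g s).snd * l t + l s * (derivationLift l g t).snd := by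
  simp [fst_derivationLift, add_comm]

/-- The derivation `T(M) → A` that extends a linear map `M → A`, where `A` is a bimodule over `T(M)`
via `l`; it is linear in the map extended. -/
def tensorDerivation : (M →ₗ[R] A) →ₗ[R] TensorAlgebra R M →ₗ[R] A :=
  LinearMap.mk₂ R (fun g t => (derivationLift l g t).snd)
    (fun g g' t => by
      induction t using TensorAlgebra.induction with
      | algebraMap r => simp only [snd_derivationLift_algebraMap, add_zero]
      | ι x => simp only [snd_derivationLift_ι, LinearMap.add_apply]
      | mul s t hs ht =>
        simp only [snd_derivationLift_mul, hs, ht, add_mul, mul_add]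
        abel
      | add s t hs ht =>
        simp only [map_add, TrivSqZeroExt.snd_add, hs, ht]
        abel)
    (fun r g t => by
      induction t using TensorAlgebra.induction with
      | algebraMap c => simp only [snd_derivationLift_algebraMap, smul_zero]
      | ι x => simp only [snd_derivationLift_ι, LinearMap.smul_apply]
      | mul s t hs ht =>
        simp only [snd_derivationLift_mul, hs, ht, smul_mul_assoc, mul_smul_comm, smul_add]
      | add s t hs ht => simp only [map_add, TrivSqZeroExt.snd_add, hs, ht, smul_add])
    (fun g s t => by simp)
    (fun r g t => by simp)

@[simp] lemma tensorDerivation_ι (g : M →ₗ[R] A) (x : M) :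
    tensorDerivation l g (TensorAlgebra.ι R x) = g x :=
  snd_derivationLift_ι l g x

lemma tensorDerivation_mul (g : M →ₗ[R] A) (s t : TensorAlgebra R M) :
    tensorDerivation l g (s * t) =
      tensorDerivation l g s * l t + l s * tensorDerivation l g t :=
  snd_derivationLift_mul l g s t

@[simp] lemma tensorDerivation_algebraMap (g : M →ₗ[R] A) (r : R) :
    tensorDerivation l g (algebraMap R _ r) = 0 :=
  snd_derivationLift_algebraMap l g r

end Derivation

variable {k : Type u} {H : Type v} {V : Type w} {W : Type w'} [Field k] [Ring H] [HopfAlgebra k H]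
  [AddCommGroup V] [Module k V] [AddCommGroup W] [Module k W]

namespace ActionCoaction

/-! ### The action of `T(V)` and `H` on `T(V) ⊗ H` -/

section Smash

variable (S : ActionCoaction k H V)

/-- The map sending `b ∈ T(V)` to `h ↦ h ▷ b`, where `h ▷ (b c) = (h₁ ▷ b)(h₂ ▷ c)`. This rule says
that it is an algebra map to the convolution algebra, which is how it is defined. -/
def tensorActConv : TensorAlgebra k V →ₐ[k] WithConv (H →ₗ[k] TensorAlgebra k V) :=
  TensorAlgebra.lift k ((WithConv.linearEquiv k _).symm.toLinearMap ∘ₗ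
    LinearMap.compRight k (TensorAlgebra.ι k) ∘ₗ S.act.flip)

lemma tensorActConv_ι (x : V) (h : H) :
    S.tensorActConv (TensorAlgebra.ι k x) h = TensorAlgebra.ι k (S.act h x) := by
  simp [tensorActConv]

lemma tensorActConv_one_right (hS : S.IsQuasiYD) (b : TensorAlgebra k V) :
    S.tensorActConv b 1 = b := by
  induction b using TensorAlgebra.induction with
  | algebraMap r => simp [Algebra.algebraMap_eq_smul_one]
  | ι x => simp [tensorActConv_ι, hS.act_one]
  | mul a b ha hb => simp [Algebra.TensorProduct.one_def, ha, hb]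
  | add a b ha hb => simp [ha, hb]

lemma tensorActConv_mul_right (hS : S.IsQuasiYD) (b : TensorAlgebra k V) (g h : H) :
    S.tensorActConv b (g * h) = S.tensorActConv (S.tensorActConv b h) g := by
  induction b using TensorAlgebra.induction generalizing g h with
  | algebraMap r =>
    simp only [Algebra.algebraMap_eq_smul_one, map_smul, map_one, Bialgebra.counit_mul, mul_smul,
      ofConv_smul, LinearMap.smul_apply, LinearMap.convOne_apply]
    rw [smul_comm (counit (R := k) h) (counit (R := k) g)]
  | ι x => simp [tensorActConv_ι, hS.act_mul]
  | mul a b ha hb =>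
    rw [map_mul S.tensorActConv, (ℛ k h).convMul_apply, convMul_apply_mul _ _ (ℛ k g) (ℛ k h),
      map_sum, ofConv_sum, LinearMap.sum_apply, Finset.sum_comm]
    simp only [map_mul S.tensorActConv, (ℛ k g).convMul_apply, ha, hb]
  | add a b ha hb => simp [ha, hb]

/-- The action of `H` on `T(V)`, `h ▷ (b c) = (h₁ ▷ b)(h₂ ▷ c)`. -/
def tensorAct (hS : S.IsQuasiYD) : H →ₐ[k] Module.End k (TensorAlgebra k V) :=
  AlgHom.ofLinearMap
    ((WithConv.linearEquiv k _).toLinearMap ∘ₗ S.tensorActConv.toLinearMap).flip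
    (LinearMap.ext fun b => S.tensorActConv_one_right hS b)
    (fun g h => LinearMap.ext fun b => S.tensorActConv_mul_right hS b g h)

lemma tensorAct_apply (hS : S.IsQuasiYD) (h : H) (b : TensorAlgebra k V) :
    S.tensorAct hS h b = S.tensorActConv b h := rfl

variable (H V) in
/-- The action of `T(V)` on `T(V) ⊗ H` by left multiplication. -/
def lmulLower : TensorAlgebra k V →ₐ[k] Module.End k (TensorAlgebra k V ⊗[k] H) :=
  (Module.endTensorEndAlgHom (R := k) (S := k) (A := k)).comp <|
    Algebra.TensorProduct.includeLeft.comp (Algebra.lmul k (TensorAlgebra k V))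

@[simp] lemma lmulLower_tmul (b c : TensorAlgebra k V) (x : H) :
    lmulLower H V b (c ⊗ₜ x) = (b * c) ⊗ₜ x := by
  simp [lmulLower, Module.endTensorEndAlgHom_apply]

/-- The action `h ▷ (b ⊗ x) = h₁ ▷ b ⊗ h₂ x` of `H` on `T(V) ⊗ H`. -/
def lmulMiddle (hS : S.IsQuasiYD) : H →ₐ[k] Module.End k (TensorAlgebra k V ⊗[k] H) :=
  (Module.endTensorEndAlgHom (R := k) (S := k) (A := k)).comp <|
    (Algebra.TensorProduct.map (S.tensorAct hS) (Algebra.lmul k H)).comp (Bialgebra.comulAlgHom k H)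

lemma lmulMiddle_tmul (hS : S.IsQuasiYD) (h : H) {ι : Type*} (r : Repr k h ι)
    (b : TensorAlgebra k V) (x : H) :
    S.lmulMiddle hS h (b ⊗ₜ x) =
      ∑ i ∈ r.index, S.tensorActConv b (r.left i) ⊗ₜ (r.right i * x) := by
  simp [lmulMiddle, ← r.eq, Module.endTensorEndAlgHom_apply, tensorAct_apply]

lemma lmulMiddle_one_tmul (hS : S.IsQuasiYD) (h x : H) :
    S.lmulMiddle hS h (1 ⊗ₜ x) = 1 ⊗ₜ (h * x) := by
  rw [S.lmulMiddle_tmul hS h (ℛ k h)]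
  simp only [map_one, LinearMap.convOne_apply, Algebra.algebraMap_eq_smul_one, smul_tmul,
    ← tmul_sum, ← smul_mul_assoc, ← Finset.sum_mul, sum_counit_smul]

end Smash

/-! ### Covariant pairs of algebra maps -/

section Covariant

variable (S : ActionCoaction k H V) {E : Type*} [Semiring E] [Algebra k E]
  (l : TensorAlgebra k V →ₐ[k] E) (a : H →ₐ[k] E)

/-- A pair of algebra maps `l : T(V) → E`, `a : H → E` is covariant if
`a(h) l(b) = l(h₁ ▷ b) a(h₂)`. -/
def IsCovariant : Prop :=
  ∀ b : TensorAlgebra k V, toConv a.toLinearMap * convConst k H (l b) =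
    convPost l (S.tensorActConv b) * toConv a.toLinearMap

variable {S l a}

lemma IsCovariant.of_ι
    (h : ∀ x : V, toConv a.toLinearMap * convConst k H (l (TensorAlgebra.ι k x)) =
      convPost l (S.tensorActConv (TensorAlgebra.ι k x)) * toConv a.toLinearMap) :
    S.IsCovariant l a := by
  intro b
  induction b using TensorAlgebra.induction with
  | algebraMap r => simp only [AlgHom.commutes, Algebra.commutes]
  | ι x => exact h x
  | mul b c hb hc =>
    rw [map_mul l, map_mul (convConst k H), ← mul_assoc, hb, mul_assoc, hc, map_mul, map_mul,
      mul_assoc]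
  | add b c hb hc => simp only [map_add, mul_add, add_mul, hb, hc]

lemma IsCovariant.mul_eq (h : S.IsCovariant l a) (b : TensorAlgebra k V) (x : H) {ι : Type*}
    (r : Repr k x ι) :
    a x * l b = ∑ i ∈ r.index, l (S.tensorActConv b (r.left i)) * a (r.right i) := by
  have hx := congrArg (fun φ : WithConv (H →ₗ[k] E) => φ x) (h b)
  simp only [convMul_convConst_apply] at hx
  rwa [r.convMul_apply] at hx

/-- As operators on `T(V) ⊗ H`, the elements of `H` are a convolution product of their actions on
the two factors; the first is covariant and the second commutes with `T(V)`. -/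
lemma isCovariant_lmul (hS : S.IsQuasiYD) : S.IsCovariant (lmulLower H V) (S.lmulMiddle hS) := by
  let actLeft : H →ₐ[k] Module.End k (TensorAlgebra k V ⊗[k] H) :=
    (Module.endTensorEndAlgHom (R := k) (S := k) (A := k)).comp <|
      Algebra.TensorProduct.includeLeft.comp (S.tensorAct hS)
  let mulRight : H →ₐ[k] Module.End k (TensorAlgebra k V ⊗[k] H) :=
    (Module.endTensorEndAlgHom (R := k) (S := k) (A := k)).comp <|
      Algebra.TensorProduct.includeRight.comp (Algebra.lmul k H)
  have hmul : toConv (S.lmulMiddle hS).toLinearMap =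
      toConv actLeft.toLinearMap * toConv mulRight.toLinearMap := by
    ext h c x
    simp only [AlgebraTensorModule.curry_apply, curry_apply, LinearMap.restrictScalars_self,
      (ℛ k h).convMul_apply]
    simp [lmulMiddle_tmul _ _ _ (ℛ k h), actLeft, mulRight, Module.endTensorEndAlgHom_apply,
      tensorAct_apply]
  intro b
  have hleft : toConv actLeft.toLinearMap * convConst k H (lmulLower H V b) =
      convPost (lmulLower H V) (S.tensorActConv b) * toConv actLeft.toLinearMap := by
    ext h c x
    rw [convMul_convConst_apply, (ℛ k h).convMul_apply]
    simp [actLeft, Module.endTensorEndAlgHom_apply, tensorAct_apply, convPost_apply,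
      (ℛ k h).convMul_apply, sum_tmul]
  have hright : toConv mulRight.toLinearMap * convConst k H (lmulLower H V b) =
      convConst k H (lmulLower H V b) * toConv mulRight.toLinearMap := by
    ext h c x
    rw [convMul_convConst_apply, convConst_convMul_apply]
    simp [mulRight, Module.endTensorEndAlgHom_apply]
  rw [hmul, mul_assoc, hright, ← mul_assoc, hleft, mul_assoc]

variable (l a) in
/-- The map `b ⊗ x ↦ l(b) a(x)`. -/
def smashMap : TensorAlgebra k V ⊗[k] H →ₗ[k] E :=
  LinearMap.mul' k E ∘ₗ TensorProduct.map l.toLinearMap a.toLinearMap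

@[simp] lemma smashMap_tmul (b : TensorAlgebra k V) (x : H) :
    smashMap l a (b ⊗ₜ x) = l b * a x := by
  simp [smashMap]

lemma smashMap_lmulLower (b : TensorAlgebra k V) (m : TensorAlgebra k V ⊗[k] H) :
    smashMap l a (lmulLower H V b m) = l b * smashMap l a m := by
  induction m with
  | zero => simp
  | tmul c x => simp [mul_assoc]
  | add m n hm hn => simp [hm, hn, mul_add]

lemma IsCovariant.smashMap_lmulMiddle (hla : S.IsCovariant l a) (hS : S.IsQuasiYD) (h : H)
    (m : TensorAlgebra k V ⊗[k] H) :
    smashMap l a (S.lmulMiddle hS h m) = a h * smashMap l a m := by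
  induction m with
  | zero => simp
  | tmul c x =>
    rw [S.lmulMiddle_tmul hS h (ℛ k h), smashMap_tmul, ← mul_assoc, hla.mul_eq c h (ℛ k h)]
    simp [Finset.sum_mul, mul_assoc]
  | add m n hm hn => simp [hm, hn, mul_add]

end Covariant

/-! ### The derivations `[f, -]` of `T(V)` -/

section Der

variable (S : ActionCoaction k H V) {E : Type*} [Semiring E] [Algebra k E]
  (l : TensorAlgebra k V →ₐ[k] E) (a : H →ₐ[k] E)

/-- For `f ∈ V^*`, the derivation `b ↦ [f, b]` of `T(V)` with values in `E`, which is `β(f, v)` on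
the generators; `E` is a bimodule over `T(V)` via `l : T(V) → E`, and `β(f, v)` is taken to `E` by
`a : H → E`. -/
def der : Module.Dual k V →ₗ[k] TensorAlgebra k V →ₗ[k] E :=
  tensorDerivation l ∘ₗ
    LinearMap.compRight k (a.toLinearMap ∘ₗ (TensorProduct.rid k H).toLinearMap) ∘ₗ
      LinearMap.lcomp k _ S.coact ∘ₗ LinearMap.lTensorHom H

@[simp] lemma der_ι (f : Module.Dual k V) (x : V) :
    S.der l a f (TensorAlgebra.ι k x) = a (S.pairing f x) := by
  simp [der, pairing]

lemma der_mul (f : Module.Dual k V) (b c : TensorAlgebra k V) :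
    S.der l a f (b * c) = S.der l a f b * l c + l b * S.der l a f c :=
  tensorDerivation_mul _ _ _ _

@[simp] lemma der_algebraMap (f : Module.Dual k V) (r : k) :
    S.der l a f (algebraMap k _ r) = 0 :=
  tensorDerivation_algebraMap _ _ _

@[simp] lemma der_one (f : Module.Dual k V) : S.der l a f 1 = 0 := by
  simpa using S.der_algebraMap l a f 1

/-- The commutators `[f, b]` as operators on `T(V) ⊗ H`. -/
abbrev derOp (hS : S.IsQuasiYD) :
    Module.Dual k V →ₗ[k] TensorAlgebra k V →ₗ[k] Module.End k (TensorAlgebra k V ⊗[k] H) :=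
  S.der (lmulLower H V) (S.lmulMiddle hS)

variable {S l a}

lemma IsCovariant.smashMap_derOp (hla : S.IsCovariant l a) (hS : S.IsQuasiYD)
    (f : Module.Dual k V) (b : TensorAlgebra k V) (m : TensorAlgebra k V ⊗[k] H) :
    smashMap l a (S.derOp hS f b m) = S.der l a f b * smashMap l a m := by
  induction b using TensorAlgebra.induction generalizing m with
  | algebraMap r => simp
  | ι x => simp [hla.smashMap_lmulMiddle]
  | mul b c hb hc => simp [der_mul, hb, hc, smashMap_lmulLower, add_mul, mul_assoc]
  | add b c hb hc => simp [hb, hc, add_mul]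

end Der

end ActionCoaction

/-! ### Commuting `V^*` past `H` -/

section Pairing

variable {R A M N : Type*} [CommSemiring R] [Semiring A] [Algebra R A]
  [AddCommMonoid M] [Module R M] [AddCommMonoid N] [Module R N]

lemma rid_lTensor_rTensor_mulRight (f : Module.Dual R M) (a : A) (t : A ⊗[R] M) :
    TensorProduct.rid R A (f.lTensor A ((LinearMap.mulRight R a).rTensor M t)) =
      TensorProduct.rid R A (f.lTensor A t) * a := by
  induction t with
  | zero => simp
  | add s t hs ht => simp only [map_add, hs, ht, add_mul]
  | tmul y v => simp

lemma rid_lTensor_map_mulLeft (f : Module.Dual R N) (a : A) (φ : M →ₗ[R] N) (t : A ⊗[R] M) :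
    TensorProduct.rid R A (f.lTensor A (TensorProduct.map (LinearMap.mulLeft R a) φ t)) =
      a * TensorProduct.rid R A ((f ∘ₗ φ).lTensor A t) := by
  induction t with
  | zero => simp
  | add s t hs ht => simp only [map_add, hs, ht, mul_add]
  | tmul y v => simp

end Pairing

namespace ActionCoaction

section

variable (S : ActionCoaction k H V) {E : Type*} [Semiring E] [Algebra k E]
  (l : TensorAlgebra k V →ₐ[k] E) (a : H →ₐ[k] E)

variable {S} in
/-- The quasi-Yetter–Drinfeld condition paired with `f`. -/
lemma IsQuasiYD.sum_pairing_act_mul (hS : S.IsQuasiYD) (f : Module.Dual k V) (x : V) (h : H)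
    {ι : Type*} (r : Repr k h ι) :
    ∑ i ∈ r.index, S.pairing f (S.act (r.left i) x) * r.right i =
      ∑ i ∈ r.index, r.left i * S.pairing (S.dualAct f (r.right i)) x := by
  have hcompat := congrArg (fun t => TensorProduct.rid k H (f.lTensor H t)) (hS.compat h x)
  simp only [← r.eq, map_sum, compatLeft, compatRight, lift.tmul, LinearMap.mk₂_apply,
    rid_lTensor_rTensor_mulRight, rid_lTensor_map_mulLeft] at hcompat
  exact hcompat

/-- The map `h ↦ [f, h ▷ b]`. -/
def derAct (f : Module.Dual k V) (b : TensorAlgebra k V) : WithConv (H →ₗ[k] E) :=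
  toConv (S.der l a f ∘ₗ (S.tensorActConv b).ofConv)

/-- The map `h ↦ [f ◁ h, b]`. -/
def derDual (f : Module.Dual k V) (b : TensorAlgebra k V) : WithConv (H →ₗ[k] E) :=
  toConv ((S.der l a).flip b ∘ₗ S.dualAct f)

lemma derAct_mul (f : Module.Dual k V) (b c : TensorAlgebra k V) :
    S.derAct l a f (b * c) = S.derAct l a f b * convPost l (S.tensorActConv c) +
      convPost l (S.tensorActConv b) * S.derAct l a f c := by
  ext h
  rw [ofConv_add, LinearMap.add_apply, (ℛ k h).convMul_apply, (ℛ k h).convMul_apply]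
  simp only [derAct, map_mul, LinearMap.comp_apply, (ℛ k h).convMul_apply, map_sum, der_mul,
    Finset.sum_add_distrib, convPost_apply]

lemma derDual_mul (f : Module.Dual k V) (b c : TensorAlgebra k V) :
    S.derDual l a f (b * c) = S.derDual l a f b * convConst k H (l c) +
      convConst k H (l b) * S.derDual l a f c := by
  ext h
  rw [ofConv_add, LinearMap.add_apply, convMul_convConst_apply, convConst_convMul_apply]
  simp [derDual, der_mul]

variable {S l a} in
/-- The identity `[f, h₁ ▷ b] h₂ = h₁ [f ◁ h₂, b]`. -/
lemma IsCovariant.derAct_mul_eq (hla : S.IsCovariant l a) (hS : S.IsQuasiYD) (f : Module.Dual k V)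
    (b : TensorAlgebra k V) :
    S.derAct l a f b * toConv a.toLinearMap = toConv a.toLinearMap * S.derDual l a f b := by
  induction b using TensorAlgebra.induction with
  | algebraMap r =>
    have hact : S.derAct l a f (algebraMap k _ r) = 0 := by
      ext h
      simp [derAct, Algebra.algebraMap_eq_smul_one]
    have hdual : S.derDual l a f (algebraMap k _ r) = 0 := by
      ext h
      simp [derDual]
    rw [hact, hdual, zero_mul, mul_zero]
  | ι x =>
    ext h
    rw [(ℛ k h).convMul_apply, (ℛ k h).convMul_apply]
    simpa [derAct, derDual, tensorActConv_ι] using congrArg a (hS.sum_pairing_act_mul f x h (ℛ k h))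
  | mul b c hb hc =>
    rw [derAct_mul, add_mul, mul_assoc, ← hla c, ← mul_assoc, hb, mul_assoc _ (S.derAct l a f c),
      hc, ← mul_assoc _ _ (S.derDual l a f c), ← hla b, derDual_mul, mul_add, mul_assoc, mul_assoc]
  | add b c hb hc =>
    have hact : S.derAct l a f (b + c) = S.derAct l a f b + S.derAct l a f c := by
      ext h; simp [derAct]
    have hdual : S.derDual l a f (b + c) = S.derDual l a f b + S.derDual l a f c := by
      ext h; simp [derDual]
    rw [hact, hdual, add_mul, mul_add, hb, hc]

end

/-! ### The representation of the free braided double on `T(V) ⊗ H` -/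

section Rep

variable (S : ActionCoaction k H V) (hS : S.IsQuasiYD)

/-- The action of `V^*` on `T(V) ⊗ H`, `f (b ⊗ x) = [f, b] (1 ⊗ x)`. -/
def upperOp : Module.Dual k V →ₗ[k] Module.End k (TensorAlgebra k V ⊗[k] H) :=
  (TensorProduct.lift.equiv (RingHom.id k) (TensorAlgebra k V) H _).toLinearMap ∘ₗ
    LinearMap.compRight k (LinearMap.lcomp k _ (TensorProduct.mk k (TensorAlgebra k V) H 1)) ∘ₗ
      S.derOp hS

@[simp] lemma upperOp_tmul (f : Module.Dual k V) (b : TensorAlgebra k V) (x : H) :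
    S.upperOp hS f (b ⊗ₜ x) = S.derOp hS f b (1 ⊗ₜ x) := by
  simp [upperOp]

/-- The action of the generators on `T(V) ⊗ H`. -/
def gensRep : Gens k H V →ₐ[k] Module.End k (TensorAlgebra k V ⊗[k] H) :=
  TensorAlgebra.lift k (LinearMap.coprod ((lmulLower H V).toLinearMap ∘ₗ TensorAlgebra.ι k)
    (LinearMap.coprod (S.lmulMiddle hS).toLinearMap (S.upperOp hS)))

@[simp] lemma gensRep_genV (x : V) :
    S.gensRep hS (genV k H V x) = lmulLower H V (TensorAlgebra.ι k x) := by
  simp [gensRep, genV]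

@[simp] lemma gensRep_genH (h : H) : S.gensRep hS (genH k H V h) = S.lmulMiddle hS h := by
  simp [gensRep, genH]

@[simp] lemma gensRep_genD (f : Module.Dual k V) :
    S.gensRep hS (genD k H V f) = S.upperOp hS f := by
  simp [gensRep, genD]

lemma upperOp_mul_lmulLower_ι (f : Module.Dual k V) (x : V) :
    S.upperOp hS f * lmulLower H V (TensorAlgebra.ι k x) =
      S.lmulMiddle hS (S.pairing f x) + lmulLower H V (TensorAlgebra.ι k x) * S.upperOp hS f := by
  ext b y
  simp [der_mul]

lemma upperOp_mul_lmulMiddle (f : Module.Dual k V) (h : H) {ι : Type*} (r : Repr k h ι) :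
    S.upperOp hS f * S.lmulMiddle hS h =
      ∑ i ∈ r.index, S.lmulMiddle hS (r.left i) * S.upperOp hS (S.dualAct f (r.right i)) := by
  ext b y
  have hder := congrArg (fun φ => φ.ofConv h (1 ⊗ₜ y)) ((isCovariant_lmul hS).derAct_mul_eq hS f b)
  simp only [r.convMul_apply] at hder
  simpa [S.lmulMiddle_tmul hS h r, derAct, derDual, lmulMiddle_one_tmul] using hder

lemma gensRep_rel {p q : Gens k H V} (h : S.Rel p q) : S.gensRep hS p = S.gensRep hS q := by
  induction h with
  | one => simp
  | mul g h => simp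
  | act h x =>
    rw [← (ℛ k h).eq]
    simp [(isCovariant_lmul hS).mul_eq _ h (ℛ k h), tensorActConv_ι]
  | dualAct f h =>
    rw [← (ℛ k h).eq]
    simp [S.upperOp_mul_lmulMiddle hS f h (ℛ k h)]
  | comm f x =>
    rw [map_sub, map_mul, map_mul, gensRep_genV, gensRep_genD, gensRep_genH,
      upperOp_mul_lmulLower_ι]
    exact add_sub_cancel_right (G := Module.End k (TensorAlgebra k V ⊗[k] H)) _ _

/-- The representation of the free braided double on `T(V) ⊗ H`. -/
def rep : S.FreeDouble →ₐ[k] Module.End k (TensorAlgebra k V ⊗[k] H) :=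
  RingQuot.liftAlgHom k ⟨S.gensRep hS, fun _ _ => S.gensRep_rel hS⟩

lemma rep_lower (b : TensorAlgebra k V) : S.rep hS (S.lower b) = lmulLower H V b := by
  have h : (S.rep hS).comp S.lower = lmulLower H V := by
    ext x : 2
    simp [rep, lower]
  exact DFunLike.congr_fun h b

lemma rep_middle (h : H) : S.rep hS (S.middle h) = S.lmulMiddle hS h := by
  simp [rep, middle]

lemma rep_upper_ι (f : Module.Dual k V) :
    S.rep hS (S.upper (TensorAlgebra.ι k f)) = S.upperOp hS f := by
  simp [rep, upper]

lemma rep_upper_one_tmul_one (t : TensorAlgebra k (Module.Dual k V)) :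
    S.rep hS (S.upper t) (1 ⊗ₜ 1) = TensorAlgebra.algebraMapInv t • (1 ⊗ₜ 1) := by
  induction t using TensorAlgebra.induction with
  | algebraMap r => simp [TensorAlgebra.algebraMapInv]
  | ι f => simp [rep_upper_ι, TensorAlgebra.algebraMapInv]
  | mul b c hb hc => simp [hb, hc, mul_smul, mul_comm (TensorAlgebra.algebraMapInv b)]
  | add b c hb hc => simp [hb, hc, add_smul]

end Rep

/-! ### Stable subspaces of `T(V)` -/

section Stable

variable (H) in
/-- The subspace `I ⊗ H` of `M ⊗ H`. -/
def tensH {M : Type*} [AddCommGroup M] [Module k M] (I : Submodule k M) : Submodule k (M ⊗[k] H) :=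
  Submodule.map₂ (TensorProduct.mk k M H) I ⊤

lemma tmul_mem_tensH {M : Type*} [AddCommGroup M] [Module k M] {I : Submodule k M} {m : M}
    (hm : m ∈ I) (x : H) : m ⊗ₜ x ∈ tensH H I :=
  Submodule.apply_mem_map₂ _ hm trivial

lemma tensH_mono {M : Type*} [AddCommGroup M] [Module k M] {I J : Submodule k M} (h : I ≤ J) :
    tensH H I ≤ tensH H J :=
  Submodule.map₂_le_map₂_left h

variable (S : ActionCoaction k H V) (hS : S.IsQuasiYD)

/-- A subspace `I` of `T^{>0}(V)` is stable if `[f, I] ⊆ I ⊗ H` for all functionals `f`, where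
`[f, b]` is identified with the element `[f, b] (1 ⊗ 1)` of `T(V) ⊗ H`. -/
structure IsStable (I : Submodule k (TensorAlgebra k V)) : Prop where
  le_positivePart : I ≤ positivePart k V
  derOp_mem : ∀ f, ∀ b ∈ I, S.derOp hS f b (1 ⊗ₜ 1) ∈ tensH H I

lemma isStable_sSup {s : Set (Submodule k (TensorAlgebra k V))}
    (h : ∀ I ∈ s, S.IsStable hS I) : S.IsStable hS (sSup s) where
  le_positivePart := sSup_le fun I hI => (h I hI).le_positivePart
  derOp_mem f := by
    have hle : sSup s ≤ (tensH H (sSup s)).comap ((LinearMap.applyₗ (1 ⊗ₜ 1)) ∘ₗ S.derOp hS f) :=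
      sSup_le fun I hI b hb => tensH_mono (le_sSup hI) ((h I hI).derOp_mem f b hb)
    exact hle

variable {S}

lemma rep_triangularSpan_mem {Im : Submodule k (TensorAlgebra k V)}
    {Ip : Submodule k (TensorAlgebra k (Module.Dual k V))}
    (hp : Ip ≤ positivePart k (Module.Dual k V)) {z : S.FreeDouble}
    (hz : z ∈ S.triangularSpan Im Ip) : S.rep hS z (1 ⊗ₜ 1) ∈ tensH H Im := by
  suffices hle : S.triangularSpan Im Ip ≤
      (tensH H Im).comap ((LinearMap.applyₗ (1 ⊗ₜ 1)) ∘ₗ (S.rep hS).toLinearMap) from hle hz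
  refine sup_le (Submodule.mul_le.2 fun y hy => ?_) (Submodule.mul_le.2 fun y _ => ?_)
  · suffices hy' : S.rep hS y (1 ⊗ₜ 1) ∈ tensH H Im by
      rintro _ ⟨t, rfl⟩
      simpa [rep_upper_one_tmul_one] using Submodule.smul_mem _ (TensorAlgebra.algebraMapInv t) hy'
    induction hy using Submodule.mul_induction_on' with
    | mem_mul_mem b hb h hh =>
      obtain ⟨b, hb, rfl⟩ := hb
      obtain ⟨h, rfl⟩ := hh
      simpa [rep_lower, rep_middle, lmulMiddle_one_tmul] using tmul_mem_tensH hb h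
    | add y _ z _ hy hz => simpa using Submodule.add_mem _ hy hz
  · rintro _ ⟨t, ht, rfl⟩
    have h0 : TensorAlgebra.algebraMapInv t = (0 : k) := hp ht
    simp [rep_upper_one_tmul_one, h0]

variable (S) in
lemma middle_one : S.middle 1 = 1 := by
  simpa [middle] using RingQuot.mkAlgHom_rel k (Rel.one (S := S))

lemma lower_mem_triangularSpan {Im : Submodule k (TensorAlgebra k V)}
    (Ip : Submodule k (TensorAlgebra k (Module.Dual k V))) {b : TensorAlgebra k V} (hb : b ∈ Im) :
    S.lower b ∈ S.triangularSpan Im Ip := by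
  refine Submodule.mem_sup_left ?_
  rw [← mul_one (S.lower b), ← mul_one (S.lower b * 1)]
  exact Submodule.mul_mem_mul (Submodule.mul_mem_mul ⟨b, hb, rfl⟩ ⟨1, S.middle_one⟩)
    ⟨1, map_one S.upper⟩

lemma IsTriangular.isStable {Im : Submodule k (TensorAlgebra k V)}
    {Ip : Submodule k (TensorAlgebra k (Module.Dual k V))} (h : S.IsTriangular Im Ip) :
    S.IsStable hS Im where
  le_positivePart := h.lower_le
  derOp_mem f b hb := by
    simpa [rep_lower, rep_upper_ι] using rep_triangularSpan_mem hS h.upper_le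
      (h.mul_left_mem (S.upper (TensorAlgebra.ι k f)) _ (lower_mem_triangularSpan Ip hb))

end Stable

end ActionCoaction

/-! ### The triangular decomposition of the free braided double -/

lemma range_tensorAlgebra_mul_le {R M A : Type*} [CommSemiring R] [AddCommMonoid M] [Module R M]
    [Semiring A] [Algebra R A] {l : TensorAlgebra R M →ₐ[R] A} {N : Submodule R A}
    (h : ∀ m, ∀ n ∈ N, l (TensorAlgebra.ι R m) * n ∈ N) :
    LinearMap.range l.toLinearMap * N ≤ N := by
  rw [Submodule.mul_le]
  rintro _ ⟨t, rfl⟩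
  induction t using TensorAlgebra.induction with
  | algebraMap r =>
    intro n hn
    simpa [← Algebra.smul_def] using Submodule.smul_mem _ r hn
  | ι m => exact h m
  | mul s t hs ht =>
    intro n hn
    simpa [mul_assoc] using hs _ (ht n hn)
  | add s t hs ht =>
    intro n hn
    simpa [add_mul] using add_mem (hs n hn) (ht n hn)

namespace ActionCoaction

section Decomposition

variable (S : ActionCoaction k H V)

/-- The image of `T(V)` in the free braided double. -/
abbrev lowerPart : Submodule k S.FreeDouble := LinearMap.range S.lower.toLinearMap

/-- The image of `H` in the free braided double. -/
abbrev middlePart : Submodule k S.FreeDouble := LinearMap.range S.middle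

/-- The image of `T(V^*)` in the free braided double. -/
abbrev upperPart : Submodule k S.FreeDouble := LinearMap.range S.upper.toLinearMap

/-- The image of `V^*` in the free braided double. -/
abbrev dualPart : Submodule k S.FreeDouble :=
  LinearMap.range (S.upper.toLinearMap ∘ₗ TensorAlgebra.ι k)

/-- The canonical map `H → Ã(V, δ)` as an algebra map. -/
def middleHom : H →ₐ[k] S.FreeDouble :=
  AlgHom.ofLinearMap S.middle S.middle_one fun g h => by
    simpa [middle] using (RingQuot.mkAlgHom_rel k (Rel.mul (S := S) g h)).symm

lemma middleHom_apply (h : H) : S.middleHom h = S.middle h := rfl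

lemma mkAlgHom_genV (x : V) :
    RingQuot.mkAlgHom k S.Rel (genV k H V x) = S.lower (TensorAlgebra.ι k x) := by
  simp [lower]

lemma mkAlgHom_genH (h : H) : RingQuot.mkAlgHom k S.Rel (genH k H V h) = S.middle h := rfl

lemma mkAlgHom_genD (f : Module.Dual k V) :
    RingQuot.mkAlgHom k S.Rel (genD k H V f) = S.upper (TensorAlgebra.ι k f) := by
  simp [upper]

lemma middle_mul_lower_ι (h : H) (x : V) {ι : Type*} (r : Repr k h ι) :
    S.middle h * S.lower (TensorAlgebra.ι k x) =
      ∑ i ∈ r.index, S.lower (TensorAlgebra.ι k (S.act (r.left i) x)) * S.middle (r.right i) := by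
  have hrel := RingQuot.mkAlgHom_rel k (Rel.act (S := S) h x)
  rw [← r.eq] at hrel
  simpa [mkAlgHom_genV, mkAlgHom_genH] using hrel

lemma upper_ι_mul_middle (f : Module.Dual k V) (h : H) {ι : Type*} (r : Repr k h ι) :
    S.upper (TensorAlgebra.ι k f) * S.middle h =
      ∑ i ∈ r.index,
        S.middle (r.left i) * S.upper (TensorAlgebra.ι k (S.dualAct f (r.right i))) := by
  have hrel := RingQuot.mkAlgHom_rel k (Rel.dualAct (S := S) f h)
  rw [← r.eq] at hrel
  simpa [mkAlgHom_genD, mkAlgHom_genH] using hrel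

lemma upper_ι_mul_lower_ι (f : Module.Dual k V) (x : V) :
    S.upper (TensorAlgebra.ι k f) * S.lower (TensorAlgebra.ι k x) =
      S.lower (TensorAlgebra.ι k x) * S.upper (TensorAlgebra.ι k f) +
        S.middle (S.pairing f x) := by
  have hrel := RingQuot.mkAlgHom_rel k (Rel.comm (S := S) f x)
  rw [map_sub, map_mul, map_mul, sub_eq_iff_eq_add'] at hrel
  simpa [mkAlgHom_genD, mkAlgHom_genV, mkAlgHom_genH] using hrel

lemma isCovariant_freeDouble : S.IsCovariant S.lower S.middleHom := by
  refine IsCovariant.of_ι fun x => ?_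
  ext h
  rw [convMul_convConst_apply, (ℛ k h).convMul_apply]
  simpa [convPost_apply, tensorActConv_ι, middleHom_apply] using S.middle_mul_lower_ι h x (ℛ k h)

lemma upper_ι_mul_lower (f : Module.Dual k V) (b : TensorAlgebra k V) :
    S.upper (TensorAlgebra.ι k f) * S.lower b =
      S.lower b * S.upper (TensorAlgebra.ι k f) + S.der S.lower S.middleHom f b := by
  induction b using TensorAlgebra.induction with
  | algebraMap r => simpa using (Algebra.commutes r (S.upper (TensorAlgebra.ι k f))).symm
  | ι x => simpa [middleHom_apply] using S.upper_ι_mul_lower_ι f x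
  | mul b c hb hc =>
    rw [map_mul, ← mul_assoc, hb, add_mul, mul_assoc, hc, der_mul, mul_add, mul_assoc]
    abel
  | add b c hb hc =>
    rw [map_add, mul_add, hb, hc, map_add, add_mul]
    abel

lemma lowerPart_mul_lowerPart_le : S.lowerPart * S.lowerPart ≤ S.lowerPart :=
  range_tensorAlgebra_mul_le <| by
    rintro x _ ⟨t, rfl⟩
    exact ⟨TensorAlgebra.ι k x * t, map_mul S.lower _ t⟩

lemma middlePart_mul_middlePart_le : S.middlePart * S.middlePart ≤ S.middlePart := by
  rw [Submodule.mul_le]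
  rintro _ ⟨g, rfl⟩ _ ⟨h, rfl⟩
  exact ⟨g * h, map_mul S.middleHom g h⟩

lemma dualPart_mul_upperPart_le : S.dualPart * S.upperPart ≤ S.upperPart := by
  rw [Submodule.mul_le]
  rintro _ ⟨f, rfl⟩ _ ⟨t, rfl⟩
  exact ⟨TensorAlgebra.ι k f * t, map_mul S.upper _ t⟩

lemma dualPart_mul_middlePart_le : S.dualPart * S.middlePart ≤ S.middlePart * S.dualPart := by
  rw [Submodule.mul_le]
  rintro _ ⟨f, rfl⟩ _ ⟨h, rfl⟩
  rw [LinearMap.comp_apply, AlgHom.toLinearMap_apply, S.upper_ι_mul_middle f h (ℛ k h)]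
  exact Submodule.sum_mem _ fun i _ => Submodule.mul_mem_mul ⟨_, rfl⟩ ⟨_, rfl⟩

lemma middlePart_mul_map_lower_le {I J : Submodule k (TensorAlgebra k V)}
    (hIJ : ∀ c ∈ I, ∀ h, S.tensorActConv c h ∈ J) :
    S.middlePart * I.map S.lower.toLinearMap ≤ J.map S.lower.toLinearMap * S.middlePart := by
  rw [Submodule.mul_le]
  rintro _ ⟨h, rfl⟩ _ ⟨c, hc, rfl⟩
  rw [AlgHom.toLinearMap_apply, ← middleHom_apply, S.isCovariant_freeDouble.mul_eq c h (ℛ k h)]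
  exact Submodule.sum_mem _ fun i _ =>
    Submodule.mul_mem_mul (Submodule.mem_map_of_mem (hIJ c hc _)) ⟨_, rfl⟩

lemma middlePart_mul_lowerPart_le : S.middlePart * S.lowerPart ≤ S.lowerPart * S.middlePart := by
  simpa only [Submodule.map_top] using
    S.middlePart_mul_map_lower_le (I := ⊤) (J := ⊤) fun _ _ _ => trivial

lemma smashMap_mem {I : Submodule k (TensorAlgebra k V)} {m : TensorAlgebra k V ⊗[k] H}
    (hm : m ∈ tensH H I) :
    smashMap S.lower S.middleHom m ∈ I.map S.lower.toLinearMap * S.middlePart := by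
  suffices hle : tensH H I ≤ (I.map S.lower.toLinearMap * S.middlePart).comap
      (smashMap S.lower S.middleHom) from hle hm
  refine Submodule.map₂_le.2 fun b hb x _ => ?_
  rw [Submodule.mem_comap, mk_apply, smashMap_tmul]
  exact Submodule.mul_mem_mul (Submodule.mem_map_of_mem hb) ⟨x, rfl⟩

variable {S} (hS : S.IsQuasiYD)

include hS in
lemma dualPart_mul_map_lower_le {I : Submodule k (TensorAlgebra k V)}
    (hI : ∀ f, ∀ b ∈ I, S.derOp hS f b (1 ⊗ₜ 1) ∈ tensH H I) :
    S.dualPart * I.map S.lower.toLinearMap ≤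
      I.map S.lower.toLinearMap * S.dualPart ⊔ I.map S.lower.toLinearMap * S.middlePart := by
  rw [Submodule.mul_le]
  rintro _ ⟨f, rfl⟩ _ ⟨b, hb, rfl⟩
  have hder : smashMap S.lower S.middleHom (S.derOp hS f b (1 ⊗ₜ 1)) =
      S.der S.lower S.middleHom f b := by
    simp [S.isCovariant_freeDouble.smashMap_derOp hS]
  rw [LinearMap.comp_apply, AlgHom.toLinearMap_apply, AlgHom.toLinearMap_apply,
    S.upper_ι_mul_lower f b, ← hder]
  exact Submodule.add_mem_sup (Submodule.mul_mem_mul (Submodule.mem_map_of_mem hb) ⟨f, rfl⟩)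
    (S.smashMap_mem (hI f b hb))

include hS in
lemma dualPart_mul_lowerPart_le :
    S.dualPart * S.lowerPart ≤ S.lowerPart * S.dualPart ⊔ S.lowerPart * S.middlePart := by
  simpa only [Submodule.map_top] using
    dualPart_mul_map_lower_le hS (I := ⊤) fun f b _ => by
      simp only [tensH, map₂_mk_top_top_eq_top, Submodule.mem_top]

lemma freeDouble_eq_top_of_one_mem {N : Submodule k S.FreeDouble} (one_mem : 1 ∈ N)
    (hlower : S.lowerPart * N ≤ N) (hmiddle : S.middlePart * N ≤ N) (hdual : S.dualPart * N ≤ N) :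
    N = ⊤ := by
  have hmul : LinearMap.range (RingQuot.mkAlgHom k S.Rel).toLinearMap * N ≤ N := by
    refine range_tensorAlgebra_mul_le fun ⟨x, h, f⟩ n hn => ?_
    have hgen : TensorAlgebra.ι k (x, h, f) = genV k H V x + (genH k H V h + genD k H V f) := by
      simp [genV, genH, genD, ← map_add]
    rw [hgen, map_add, map_add, mkAlgHom_genV, mkAlgHom_genH, mkAlgHom_genD, add_mul, add_mul]
    exact add_mem (hlower (Submodule.mul_mem_mul ⟨_, rfl⟩ hn)) <|
      add_mem (hmiddle (Submodule.mul_mem_mul ⟨h, rfl⟩ hn))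
        (hdual (Submodule.mul_mem_mul ⟨f, rfl⟩ hn))
  refine eq_top_iff.2 fun a _ => ?_
  obtain ⟨t, rfl⟩ := RingQuot.mkAlgHom_surjective k S.Rel a
  simpa using hmul (Submodule.mul_mem_mul ⟨t, rfl⟩ one_mem)

include hS in
lemma lowerPart_mul_middlePart_mul_upperPart :
    S.lowerPart * S.middlePart * S.upperPart = ⊤ := by
  have hmiddle : S.middlePart * (S.lowerPart * S.middlePart * S.upperPart) ≤
      S.lowerPart * S.middlePart * S.upperPart := calc
    _ = S.middlePart * S.lowerPart * S.middlePart * S.upperPart := by simp only [mul_assoc]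
    _ ≤ S.lowerPart * S.middlePart * S.middlePart * S.upperPart := by
      gcongr ?_ * _ * _; exact S.middlePart_mul_lowerPart_le
    _ ≤ S.lowerPart * S.middlePart * S.upperPart := by
      rw [mul_assoc S.lowerPart]; gcongr; exact S.middlePart_mul_middlePart_le
  have hdual : S.dualPart * (S.lowerPart * S.middlePart * S.upperPart) ≤
      S.lowerPart * S.middlePart * S.upperPart := calc
    _ = S.dualPart * S.lowerPart * S.middlePart * S.upperPart := by simp only [mul_assoc]
    _ ≤ (S.lowerPart * S.dualPart ⊔ S.lowerPart * S.middlePart) * S.middlePart * S.upperPart := by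
      gcongr; exact dualPart_mul_lowerPart_le hS
    _ = S.lowerPart * (S.dualPart * S.middlePart) * S.upperPart ⊔
        S.lowerPart * (S.middlePart * S.middlePart) * S.upperPart := by
      simp only [Submodule.sup_mul, mul_assoc]
    _ ≤ S.lowerPart * (S.middlePart * S.dualPart) * S.upperPart ⊔
        S.lowerPart * S.middlePart * S.upperPart := by
      gcongr _ * ?_ * _ ⊔ _ * ?_ * _
      exacts [S.dualPart_mul_middlePart_le, S.middlePart_mul_middlePart_le]
    _ = S.lowerPart * S.middlePart * (S.dualPart * S.upperPart) ⊔
        S.lowerPart * S.middlePart * S.upperPart := by simp only [mul_assoc]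
    _ ≤ S.lowerPart * S.middlePart * S.upperPart := by
      refine sup_le ?_ le_rfl; gcongr; exact S.dualPart_mul_upperPart_le
  refine freeDouble_eq_top_of_one_mem ?_ ?_ hmiddle hdual
  · have hlower : (1 : S.FreeDouble) ∈ S.lowerPart := ⟨1, map_one S.lower⟩
    have hmiddle : (1 : S.FreeDouble) ∈ S.middlePart := ⟨1, S.middle_one⟩
    have hupper : (1 : S.FreeDouble) ∈ S.upperPart := ⟨1, map_one S.upper⟩
    simpa using Submodule.mul_mem_mul (Submodule.mul_mem_mul hlower hmiddle) hupper
  · rw [← mul_assoc, ← mul_assoc]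
    gcongr
    exact S.lowerPart_mul_lowerPart_le

end Decomposition

end ActionCoaction

namespace ActionCoaction

/-! ### The triangular ideal generated by a stable subspace -/

section Hull

variable (S : ActionCoaction k H V)

/-- The `H`-submodule of `T(V)` generated by `I`. -/
def actSpan (I : Submodule k (TensorAlgebra k V)) : Submodule k (TensorAlgebra k V) :=
  Submodule.map₂ ((WithConv.linearEquiv k _).toLinearMap ∘ₗ S.tensorActConv.toLinearMap) I ⊤

/-- The `H`-stable ideal of `T(V)` generated by `I`. -/
def idealHull (I : Submodule k (TensorAlgebra k V)) : Submodule k (TensorAlgebra k V) :=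
  ⊤ * S.actSpan I * ⊤

variable {S} {I : Submodule k (TensorAlgebra k V)}

lemma actSpan_le_iff {p : Submodule k (TensorAlgebra k V)} :
    S.actSpan I ≤ p ↔ ∀ c ∈ I, ∀ h : H, S.tensorActConv c h ∈ p :=
  Submodule.map₂_le.trans (by simp)

lemma tensorActConv_mem_actSpan {c : TensorAlgebra k V} (hc : c ∈ I) (h : H) :
    S.tensorActConv c h ∈ S.actSpan I :=
  actSpan_le_iff.1 le_rfl c hc h

lemma le_idealHull (hS : S.IsQuasiYD) : I ≤ S.idealHull I := fun c hc => by
  have hact : c ∈ S.actSpan I := by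
    simpa [S.tensorActConv_one_right hS] using tensorActConv_mem_actSpan (S := S) hc 1
  simpa [idealHull] using Submodule.mul_mem_mul
    (Submodule.mul_mem_mul (Submodule.mem_top (x := 1)) hact) (Submodule.mem_top (x := 1))

variable (S) in
lemma algebraMapInv_tensorActConv (b : TensorAlgebra k V) (h : H) :
    TensorAlgebra.algebraMapInv (S.tensorActConv b h) =
      counit (R := k) h * TensorAlgebra.algebraMapInv b := by
  have heq : (convPost TensorAlgebra.algebraMapInv).comp S.tensorActConv =
      (Algebra.ofId k (WithConv (H →ₗ[k] k))).comp TensorAlgebra.algebraMapInv := by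
    ext x h
    simp [convPost_apply, tensorActConv_ι, TensorAlgebra.algebraMapInv]
  have hb := congrArg (fun φ => (φ b).ofConv h) heq
  simpa [convPost_apply, Algebra.ofId_apply, mul_comm] using hb

lemma idealHull_le_positivePart (hI : I ≤ positivePart k V) : S.idealHull I ≤ positivePart k V := by
  have hact : S.actSpan I ≤ positivePart k V := actSpan_le_iff.2 fun c hc h => by
    have hc : TensorAlgebra.algebraMapInv c = (0 : k) := hI hc
    change TensorAlgebra.algebraMapInv (S.tensorActConv c h) = (0 : k)
    rw [algebraMapInv_tensorActConv, hc, mul_zero]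
  rw [positivePart, LinearMap.le_ker_iff_map] at hact ⊢
  rw [idealHull, Submodule.map_mul, Submodule.map_mul, hact, Submodule.mul_bot, Submodule.bot_mul]

lemma IsCovariant.convPost_tensorActConv {E : Type*} [Semiring E] [Algebra k E]
    {l : TensorAlgebra k V →ₐ[k] E} {a : H →ₐ[k] E} (hla : S.IsCovariant l a)
    (b : TensorAlgebra k V) :
    convPost l (S.tensorActConv b) = toConv a.toLinearMap * convConst k H (l b) *
      toConv (a.toLinearMap ∘ₗ HopfAlgebra.antipode k) := by
  rw [hla, mul_assoc, conv_mul_antipode, mul_one]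

lemma map_lower_actSpan_le : (S.actSpan I).map S.lower.toLinearMap ≤
    S.middlePart * I.map S.lower.toLinearMap * S.middlePart := by
  refine Submodule.map_le_iff_le_comap.2 (actSpan_le_iff.2 fun c hc h => ?_)
  rw [Submodule.mem_comap, AlgHom.toLinearMap_apply, ← convPost_apply,
    S.isCovariant_freeDouble.convPost_tensorActConv]
  refine convMul_apply_mem (fun g h => ?_) h
  rw [convMul_convConst_apply]
  exact Submodule.mul_mem_mul
    (Submodule.mul_mem_mul ⟨g, rfl⟩ (Submodule.mem_map_of_mem hc)) ⟨_, rfl⟩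

lemma map_lower_idealHull : (S.idealHull I).map S.lower.toLinearMap =
    S.lowerPart * (S.actSpan I).map S.lower.toLinearMap * S.lowerPart := by
  rw [idealHull, Submodule.map_mul, Submodule.map_mul, Submodule.map_top]

lemma triangularSpan_bot : S.triangularSpan I ⊥ =
    I.map S.lower.toLinearMap * S.middlePart * S.upperPart := by
  rw [triangularSpan, Submodule.map_bot, Submodule.mul_bot, sup_bot_eq]

variable {hS : S.IsQuasiYD}

lemma IsStable.upperPart_mul_le (hI : S.IsStable hS I) :
    S.upperPart * (I.map S.lower.toLinearMap * ⊤) ≤ I.map S.lower.toLinearMap * ⊤ := by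
  refine range_tensorAlgebra_mul_le fun f n hn => ?_
  have hdual : S.dualPart * (I.map S.lower.toLinearMap * ⊤) ≤ I.map S.lower.toLinearMap * ⊤ := by
    rw [← mul_assoc]
    refine (mul_le_mul_left (dualPart_mul_map_lower_le hS hI.derOp_mem) _).trans ?_
    rw [Submodule.sup_mul, mul_assoc, mul_assoc]
    exact sup_le (mul_le_mul_right le_top _) (mul_le_mul_right le_top _)
  exact hdual (Submodule.mul_mem_mul ⟨f, rfl⟩ hn)

/-- The ideal generated by `I` is `T(V) H I Ã(V, δ)` because `T(V^*) I ⊆ I Ã(V, δ)`, and here the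
factor `H` can be moved to the right of `I` at the cost of replacing `I` by its `H`-span. -/
lemma IsStable.triangularSpan_idealHull (hI : S.IsStable hS I) :
    S.triangularSpan (S.idealHull I) ⊥ = ⊤ * I.map S.lower.toLinearMap * ⊤ := by
  rw [triangularSpan_bot, map_lower_idealHull]
  set X := I.map S.lower.toLinearMap
  set Y := (S.actSpan I).map S.lower.toLinearMap
  have hXY : S.middlePart * X ≤ Y * S.middlePart :=
    S.middlePart_mul_map_lower_le fun c hc => tensorActConv_mem_actSpan hc
  have hHT : S.middlePart * (S.lowerPart * S.middlePart) ≤ S.lowerPart * S.middlePart := calc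
    _ = S.middlePart * S.lowerPart * S.middlePart := (mul_assoc _ _ _).symm
    _ ≤ S.lowerPart * S.middlePart * S.middlePart := by
      gcongr ?_ * _; exact S.middlePart_mul_lowerPart_le
    _ ≤ S.lowerPart * S.middlePart := by
      rw [mul_assoc]; gcongr; exact S.middlePart_mul_middlePart_le
  refine le_antisymm ?_ ?_
  · calc S.lowerPart * Y * S.lowerPart * S.middlePart * S.upperPart
      _ ≤ S.lowerPart * (S.middlePart * X * S.middlePart) * S.lowerPart * S.middlePart *
          S.upperPart := by gcongr; exact map_lower_actSpan_le
      _ = S.lowerPart * S.middlePart * X *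
          (S.middlePart * S.lowerPart * S.middlePart * S.upperPart) := by simp only [mul_assoc]
      _ ≤ ⊤ * X * ⊤ := by gcongr <;> exact le_top
  · calc ⊤ * X * ⊤
      _ = S.lowerPart * S.middlePart * (S.upperPart * (X * ⊤)) := by
        conv_lhs => rw [← lowerPart_mul_middlePart_mul_upperPart hS, mul_assoc, mul_assoc]
        rw [lowerPart_mul_middlePart_mul_upperPart hS]
      _ ≤ S.lowerPart * S.middlePart * (X * ⊤) := by gcongr _ * ?_; exact hI.upperPart_mul_le
      _ = S.lowerPart * (S.middlePart * X) * ⊤ := by simp only [mul_assoc]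
      _ ≤ S.lowerPart * (Y * S.middlePart) * ⊤ := by gcongr _ * ?_ * _
      _ = S.lowerPart * Y * (S.middlePart * (S.lowerPart * S.middlePart)) * S.upperPart := by
        rw [← lowerPart_mul_middlePart_mul_upperPart hS]; simp only [mul_assoc]
      _ ≤ S.lowerPart * Y * (S.lowerPart * S.middlePart) * S.upperPart := by gcongr _ * ?_ * _
      _ = S.lowerPart * Y * S.lowerPart * S.middlePart * S.upperPart := by simp only [mul_assoc]

lemma IsStable.isTriangular (hI : S.IsStable hS I) : S.IsTriangular (S.idealHull I) ⊥ where
  lower_le := idealHull_le_positivePart hI.le_positivePart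
  upper_le := bot_le
  mul_left_mem a b hb := by
    rw [hI.triangularSpan_idealHull, mul_assoc] at hb ⊢
    have hle : ⊤ * (⊤ * (I.map S.lower.toLinearMap * ⊤)) ≤ ⊤ * (I.map S.lower.toLinearMap * ⊤) := by
      rw [← mul_assoc]
      exact mul_le_mul_left le_top _
    exact hle (Submodule.mul_mem_mul trivial hb)
  mul_right_mem a b hb := by
    rw [hI.triangularSpan_idealHull] at hb ⊢
    have hle : ⊤ * I.map S.lower.toLinearMap * ⊤ * ⊤ ≤ ⊤ * I.map S.lower.toLinearMap * ⊤ := by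
      rw [mul_assoc _ ⊤ ⊤]
      exact mul_le_mul_right le_top _
    exact hle (Submodule.mul_mem_mul hb trivial)

lemma isStable_lowerIdeal : S.IsStable hS S.lowerIdeal :=
  S.isStable_sSup hS fun _ ⟨_, h⟩ => h.isStable hS

lemma IsStable.le_lowerIdeal (hI : S.IsStable hS I) : I ≤ S.lowerIdeal :=
  (le_idealHull hS).trans (le_sSup ⟨⊥, hI.isTriangular⟩)

end Hull

end ActionCoaction

/-! ### Perfect subquotients -/

section LinearAlgebra

/-- The algebra map `T(V) → T(W)` induced by a linear map. -/
abbrev tensorMap (μ : V →ₗ[k] W) : TensorAlgebra k V →ₐ[k] TensorAlgebra k W :=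
  TensorAlgebra.lift k (TensorAlgebra.ι k ∘ₗ μ)

lemma algebraMapInv_tensorMap (μ : V →ₗ[k] W) (b : TensorAlgebra k V) :
    TensorAlgebra.algebraMapInv (tensorMap μ b) = (TensorAlgebra.algebraMapInv b : k) := by
  have h : TensorAlgebra.algebraMapInv.comp (tensorMap μ) =
      (TensorAlgebra.algebraMapInv : TensorAlgebra k V →ₐ[k] k) := by
    ext x
    simp [TensorAlgebra.algebraMapInv]
  exact DFunLike.congr_fun h b

lemma comap_positivePart (μ : V →ₗ[k] W) :
    (positivePart k W).comap (tensorMap μ).toLinearMap = positivePart k V := by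
  ext b
  simp [positivePart, algebraMapInv_tensorMap]

section Coalgebra

variable {R C : Type*} [CommSemiring R] [AddCommMonoid C] [Module R C] [Coalgebra R C]

/-- The map `c ↦ c₁ γ(c₂)`, linear in the functional `γ`. -/
def rightHit : (C →ₗ[R] R) →ₗ[R] C →ₗ[R] C :=
  LinearMap.lcomp R C comul ∘ₗ LinearMap.compRight R (TensorProduct.rid R C).toLinearMap ∘ₗ
    LinearMap.lTensorHom C

lemma rightHit_apply (γ : C →ₗ[R] R) {c : C} {ι : Type*} (r : Repr R c ι) :
    rightHit γ c = ∑ i ∈ r.index, γ (r.right i) • r.left i := by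
  simp [rightHit, ← r.eq]

end Coalgebra

lemma eventually_eq_sum_coord {R M N ι : Type*} [CommRing R] [AddCommGroup M] [Module R M]
    [AddCommGroup N] [Module R N] (e : Module.Basis ι R M) (t : N ⊗[R] M) :
    ∀ᶠ F : Finset ι in Filter.atTop,
      t = ∑ j ∈ F, TensorProduct.rid R N ((e.coord j).lTensor N t) ⊗ₜ e j := by
  induction t with
  | zero => simp
  | tmul y x =>
    filter_upwards [Filter.eventually_ge_atTop (e.repr x).support] with F hF
    have hx : x = ∑ j ∈ F, e.repr x j • e j := by
      conv_lhs => rw [← e.linearCombination_repr x, Finsupp.linearCombination_apply,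
        Finsupp.sum_of_support_subset _ hF _ (by simp)]
    conv_lhs => rw [hx]
    simp [tmul_sum, smul_tmul]
  | add s t hs ht =>
    filter_upwards [hs, ht] with F hs ht
    conv_lhs => rw [hs, ht]
    simp [add_tmul, Finset.sum_add_distrib]

end LinearAlgebra

namespace ActionCoaction

section TensH

variable {M N : Type*} [AddCommGroup M] [Module k M] [AddCommGroup N] [Module k N]

lemma tensH_eq_ker (I : Submodule k M) : tensH H I = LinearMap.ker (I.mkQ.rTensor H) := by
  refine le_antisymm (Submodule.map₂_le.2 fun b hb x _ => ?_) fun m hm => ?_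
  · have hb : I.mkQ b = 0 := by simpa using hb
    rw [LinearMap.mem_ker, mk_apply, LinearMap.rTensor_tmul, hb, zero_tmul]
  · rw [rTensor_mkQ] at hm
    obtain ⟨z, rfl⟩ := hm
    induction z with
    | zero => simp
    | tmul b x => simpa using tmul_mem_tensH b.2 x
    | add z z' hz hz' => simpa using add_mem hz hz'

lemma mem_tensH_comap {I : Submodule k N} {φ : M →ₗ[k] N} {m : M ⊗[k] H}
    (hm : φ.rTensor H m ∈ tensH H I) : m ∈ tensH H (I.comap φ) := by
  rw [tensH_eq_ker, LinearMap.mem_ker] at hm ⊢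
  have hinj : Function.Injective ((I.comap φ).mapQ I φ le_rfl) := by
    rw [← LinearMap.ker_eq_bot, Submodule.ker_mapQ, Submodule.mkQ_map_self]
  apply Module.Flat.rTensor_preserves_injective_linearMap (M := H) _ hinj
  rw [map_zero, ← hm, ← LinearMap.comp_apply, ← LinearMap.comp_apply, ← LinearMap.rTensor_comp,
    ← LinearMap.rTensor_comp, Submodule.mapQ_mkQ]

lemma map_mem_tensH {I : Submodule k M} (φ : M →ₗ[k] N) (ψ : H →ₗ[k] H) {m : M ⊗[k] H}
    (hm : m ∈ tensH H I) : TensorProduct.map φ ψ m ∈ tensH H (I.map φ) := by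
  suffices hle : tensH H I ≤ (tensH H (I.map φ)).comap (TensorProduct.map φ ψ) from hle hm
  exact Submodule.map₂_le.2 fun b hb x _ => tmul_mem_tensH (Submodule.mem_map_of_mem hb) (ψ x)

end TensH

variable {S : ActionCoaction k H V} {T : ActionCoaction k H W} {μ : V →ₗ[k] W}

section TensorMap

lemma map_tensorMap_lmulLower (ψ : H →ₗ[k] H) (b : TensorAlgebra k V)
    (m : TensorAlgebra k V ⊗[k] H) :
    TensorProduct.map (tensorMap μ).toLinearMap ψ (lmulLower H V b m) =
      lmulLower H W (tensorMap μ b) (TensorProduct.map (tensorMap μ).toLinearMap ψ m) := by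
  induction m with
  | zero => simp
  | tmul c x => simp
  | add m n hm hn => simp only [map_add, hm, hn]

variable (hμ : ∀ (h : H) (x : V), μ (S.act h x) = T.act h (μ x))
include hμ

lemma tensorActConv_tensorMap (b : TensorAlgebra k V) (h : H) :
    T.tensorActConv (tensorMap μ b) h = tensorMap μ (S.tensorActConv b h) := by
  have heq : T.tensorActConv.comp (tensorMap μ) =
      (convPost (tensorMap μ)).comp S.tensorActConv := by
    ext x h
    simp [convPost_apply, tensorActConv_ι, hμ]
  exact congrArg (fun φ => (φ b).ofConv h) heq

lemma rTensor_tensorMap_lmulMiddle (hS : S.IsQuasiYD) (hT : T.IsQuasiYD) (h : H)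
    (m : TensorAlgebra k V ⊗[k] H) :
    (tensorMap μ).toLinearMap.rTensor H (S.lmulMiddle hS h m) =
      T.lmulMiddle hT h ((tensorMap μ).toLinearMap.rTensor H m) := by
  induction m with
  | zero => simp
  | tmul c x =>
    rw [S.lmulMiddle_tmul hS h (ℛ k h), LinearMap.rTensor_tmul, T.lmulMiddle_tmul hT h (ℛ k h)]
    simp [tensorActConv_tensorMap hμ]
  | add m n hm hn => simp only [map_add, hm, hn]

end TensorMap

section Comap

variable {ν : W →ₗ[k] V} (h : IsSubquotient S T μ ν) (hS : S.IsQuasiYD) (hT : T.IsQuasiYD)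
include h

lemma pairing_comp_of_isSubquotient (f : Module.Dual k V) (x : V) :
    T.pairing (f ∘ₗ ν) (μ x) = S.pairing f x := by
  rw [pairing, pairing, h.coact_eq, LinearMap.lTensor_comp]
  rfl

lemma rTensor_tensorMap_derOp (f : Module.Dual k V) (b : TensorAlgebra k V)
    (m : TensorAlgebra k V ⊗[k] H) :
    (tensorMap μ).toLinearMap.rTensor H (S.derOp hS f b m) =
      T.derOp hT (f ∘ₗ ν) (tensorMap μ b) ((tensorMap μ).toLinearMap.rTensor H m) := by
  induction b using TensorAlgebra.induction generalizing m with
  | algebraMap r => simp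
  | ι x =>
    simp [rTensor_tensorMap_lmulMiddle h.map_act_left hS hT, pairing_comp_of_isSubquotient h]
  | mul b c hb hc =>
    have hlower := fun b m => map_tensorMap_lmulLower (μ := μ) (LinearMap.id : H →ₗ[k] H) b m
    simp only [← LinearMap.rTensor_def] at hlower
    simp [der_mul, hb, hc, hlower]
  | add b c hb hc => simp [hb, hc]

variable {hS hT}

lemma isStable_comap {I : Submodule k (TensorAlgebra k W)} (hI : T.IsStable hT I) :
    S.IsStable hS (I.comap (tensorMap μ).toLinearMap) where
  le_positivePart := comap_positivePart μ ▸ Submodule.comap_mono hI.le_positivePart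
  derOp_mem f b hb := by
    refine mem_tensH_comap ?_
    rw [rTensor_tensorMap_derOp h hS hT, LinearMap.rTensor_tmul, AlgHom.toLinearMap_apply, map_one]
    exact hI.derOp_mem _ _ hb

end Comap

section Map

variable {τ : H ⊗[k] V →ₗ[k] W} (hμ : ∀ (h : H) (x : V), μ (S.act h x) = T.act h (μ x))
  (hτ : ∀ x, T.coact (μ x) = τ.lTensor H (S.Y.coact (S.coact x)))
  (hS : S.IsQuasiYD) (hT : T.IsQuasiYD)

include hμ in
lemma lmulMiddle_rightHit (γ : H →ₗ[k] k) (h : H) (c : TensorAlgebra k V) :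
    T.lmulMiddle hT (rightHit γ h) (tensorMap μ c ⊗ₜ 1) =
      TensorProduct.map (tensorMap μ).toLinearMap (rightHit γ) (S.lmulMiddle hS h (c ⊗ₜ 1)) := by
  have hcoassoc := congrArg
    (TensorProduct.map ((tensorMap μ).toLinearMap ∘ₗ (S.tensorActConv c).ofConv)
      ((TensorProduct.rid k H).toLinearMap ∘ₗ γ.lTensor H))
    (sum_tmul_tmul_eq (ℛ k h) (fun i => ℛ k _) (fun i => ℛ k _))
  rw [S.lmulMiddle_tmul hS h (ℛ k h), rightHit_apply γ (ℛ k h)]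
  simp only [map_sum, TensorProduct.map_tmul, LinearMap.comp_apply, LinearMap.lTensor_tmul,
    LinearEquiv.coe_coe, TensorProduct.rid_tmul, AlgHom.toLinearMap_apply] at hcoassoc
  simp only [map_sum, map_smul, LinearMap.sum_apply, LinearMap.smul_apply,
    T.lmulMiddle_tmul hT _ (ℛ k _), TensorProduct.map_tmul, mul_one, AlgHom.toLinearMap_apply,
    rightHit_apply γ (ℛ k _), tensorActConv_tensorMap hμ, Finset.smul_sum, ← tmul_smul, tmul_sum]
  exact hcoassoc

include hτ in
lemma eventually_pairing_eq_sum {ι : Type*} (e : Module.Basis ι k V) (g : Module.Dual k W) (x : V) :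
    ∀ᶠ F : Finset ι in Filter.atTop, T.pairing g (μ x) =
      ∑ j ∈ F, rightHit (g ∘ₗ τ ∘ₗ (TensorProduct.mk k H V).flip (e j))
        (S.pairing (e.coord j) x) := by
  filter_upwards [eventually_eq_sum_coord e (S.coact x)] with F hF
  rw [pairing, hτ, hF]
  simp only [map_sum]
  refine Finset.sum_congr rfl fun j _ => ?_
  rw [pairing, rightHit_apply _ (ℛ k _), Y, LinearMap.comp_apply, LinearMap.rTensor_tmul,
    ← (ℛ k _).eq]
  simp [sum_tmul]

include hμ hτ in
/-- For `c = 1` this expresses `[g, T(μ) b]` through the `[f, b]`, up to maps which take `I ⊗ H` to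
`T(μ) I ⊗ H`; general `c` is needed for the induction on `b`. -/
lemma eventually_derOp_eq_sum {ι : Type*} (e : Module.Basis ι k V) (g : Module.Dual k W)
    (b : TensorAlgebra k V) :
    ∀ᶠ F : Finset ι in Filter.atTop, ∀ c, T.derOp hT g (tensorMap μ b) (tensorMap μ c ⊗ₜ 1) =
      ∑ j ∈ F, TensorProduct.map (tensorMap μ).toLinearMap
        (rightHit (g ∘ₗ τ ∘ₗ (TensorProduct.mk k H V).flip (e j)))
          (S.derOp hS (e.coord j) b (c ⊗ₜ 1)) := by
  induction b using TensorAlgebra.induction with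
  | algebraMap r => simp
  | ι x =>
    filter_upwards [eventually_pairing_eq_sum hτ e g x] with F hF c
    simp only [TensorAlgebra.lift_ι_apply, LinearMap.comp_apply, der_ι, hF, map_sum,
      LinearMap.sum_apply, lmulMiddle_rightHit hμ hS hT]
  | mul b b' hb hb' =>
    filter_upwards [hb, hb'] with F hb hb' c
    have hbc := hb (b' * c)
    simp only [map_mul (tensorMap μ), der_mul, LinearMap.add_apply, Module.End.mul_apply,
      lmulLower_tmul, map_add, Finset.sum_add_distrib, map_tensorMap_lmulLower] at hbc ⊢
    rw [hbc, hb', map_sum]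
  | add b b' hb hb' =>
    filter_upwards [hb, hb'] with F hb hb' c
    simp only [map_add, LinearMap.add_apply, hb, hb', Finset.sum_add_distrib]

variable {hS hT}

include hμ hτ in
lemma isStable_map {I : Submodule k (TensorAlgebra k V)} (hI : S.IsStable hS I) :
    T.IsStable hT (I.map (tensorMap μ).toLinearMap) where
  le_positivePart := by
    rw [Submodule.map_le_iff_le_comap, comap_positivePart]
    exact hI.le_positivePart
  derOp_mem g := by
    rintro _ ⟨b, hb, rfl⟩
    obtain ⟨F, hF⟩ :=
      (eventually_derOp_eq_sum hμ hτ hS hT (Module.Basis.ofVectorSpace k V) g b).exists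
    have hsum := hF 1
    rw [map_one] at hsum
    rw [AlgHom.toLinearMap_apply, hsum]
    exact Submodule.sum_mem _ fun j _ => map_mem_tensH _ _ (hI.derOp_mem _ b hb)

end Map

end ActionCoaction

open ActionCoaction in
lemma IsSubquotient.isPerfectSubquotient {S : ActionCoaction k H V} {T : ActionCoaction k H W}
    {μ : V →ₗ[k] W} {ν : W →ₗ[k] V} (h : IsSubquotient S T μ ν) (hS : S.IsQuasiYD)
    (hT : T.IsQuasiYD) (τ : H ⊗[k] V →ₗ[k] W)
    (hτ : ∀ x, T.coact (μ x) = τ.lTensor H (S.Y.coact (S.coact x))) :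
    IsPerfectSubquotient S T μ ν where
  toIsSubquotient := h
  lowerIdeal_eq := le_antisymm
    (Submodule.map_le_iff_le_comap.1
      (isStable_map h.map_act_left hτ (isStable_lowerIdeal (hS := hS)) (hT := hT)).le_lowerIdeal)
    (isStable_comap h (isStable_lowerIdeal (hS := hT)) (hS := hS)).le_lowerIdeal

/-! ### Convolution of operators -/

section Convolution

variable {R : Type*} [CommSemiring R] {C : Type*} {E : Type*} [Semiring E] [Algebra R E]
  {N : Type*} [AddCommMonoid N] [Module R N] {N' : Type*} [AddCommMonoid N'] [Module R N']

section Coalgebra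

variable [AddCommMonoid C] [Module R C] [Coalgebra R C]

lemma commute_convMul {φ ψ : WithConv (C →ₗ[R] E)} {a : E} (hφ : ∀ c, Commute (φ c) a)
    (hψ : ∀ c, Commute (ψ c) a) (c : C) : Commute ((φ * ψ) c) a := by
  rw [(ℛ R c).convMul_apply]
  exact Commute.sum_left _ _ _ fun i _ => (hφ _).mul_left (hψ _)

lemma convMul_intertwine (ν : N →ₗ[R] N') {φ ψ : WithConv (C →ₗ[R] Module.End R N)}
    {φ' ψ' : WithConv (C →ₗ[R] Module.End R N')} (hφ : ∀ c x, ν (φ c x) = φ' c (ν x))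
    (hψ : ∀ c x, ν (ψ c x) = ψ' c (ν x)) (c : C) (x : N) :
    ν ((φ * ψ) c x) = (φ' * ψ') c (ν x) := by
  simp [(ℛ R c).convMul_apply, hφ, hψ]

/-- The right action of the convolution algebra `Hom(C, End(N)ᵐᵒᵖ)` on `Hom(C, N)`, which takes `φ`
to `c ↦ B(c₂) (φ(c₁))`. -/
def convApply (φ : C →ₗ[R] N) (B : WithConv (C →ₗ[R] (Module.End R N)ᵐᵒᵖ)) : C →ₗ[R] N :=
  TensorProduct.lift (((opLinearEquiv R).symm.toLinearMap ∘ₗ B.ofConv).flip ∘ₗ φ) ∘ₗ comul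

lemma convApply_apply (φ : C →ₗ[R] N) (B : WithConv (C →ₗ[R] (Module.End R N)ᵐᵒᵖ)) {c : C}
    {ι : Type*} (r : Repr R c ι) :
    convApply φ B c = ∑ i ∈ r.index, (B (r.right i)).unop (φ (r.left i)) := by
  simp [convApply, ← r.eq]

@[simp] lemma convApply_one (φ : C →ₗ[R] N) : convApply φ 1 = φ := by
  ext c
  conv_rhs => rw [← sum_smul_counit (R := R) (ℛ R c)]
  simp [convApply_apply φ _ (ℛ R c), Algebra.algebraMap_eq_smul_one]

lemma convApply_mul (φ : C →ₗ[R] N) (B D : WithConv (C →ₗ[R] (Module.End R N)ᵐᵒᵖ)) :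
    convApply φ (B * D) = convApply (convApply φ B) D := by
  ext c
  have hcoassoc := congrArg
    (TensorProduct.lift (((opLinearEquiv R).symm.toLinearMap ∘ₗ
      LinearMap.mul' R (Module.End R N)ᵐᵒᵖ ∘ₗ TensorProduct.map B.ofConv D.ofConv).flip ∘ₗ φ))
    (sum_tmul_tmul_eq (ℛ R c) (fun i => ℛ R _) (fun i => ℛ R _))
  simp only [map_sum, lift.tmul, LinearMap.comp_apply, LinearMap.flip_apply,
    TensorProduct.map_tmul, LinearMap.mul'_apply, LinearEquiv.coe_coe, coe_opLinearEquiv_symm,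
    unop_mul] at hcoassoc
  simp only [convApply_apply _ _ (ℛ R _), (ℛ R _).convMul_apply, map_sum, Finset.unop_sum, unop_mul,
    LinearMap.sum_apply]
  exact hcoassoc.symm

lemma convApply_eq_iff {φ ψ : C →ₗ[R] N} {B D : WithConv (C →ₗ[R] (Module.End R N)ᵐᵒᵖ)}
    (hBD : B * D = 1) (hDB : D * B = 1) : convApply φ B = ψ ↔ φ = convApply ψ D := by
  constructor <;> rintro rfl <;> simp [← convApply_mul, hBD, hDB]

end Coalgebra

section Bialgebra

variable [Semiring C] [Bialgebra R C]

/-- The convolution of two algebra maps with commuting images is an algebra map. -/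
def convHom (f g : C →ₐ[R] E) (hfg : ∀ x y, Commute (f x) (g y)) : C →ₐ[R] E :=
  AlgHom.ofLinearMap (toConv f.toLinearMap * toConv g.toLinearMap).ofConv
    (by simp [Algebra.TensorProduct.one_def])
    fun x y => by
      rw [convMul_apply_mul _ _ (ℛ R x) (ℛ R y), (ℛ R x).convMul_apply,
        (ℛ R y).convMul_apply, Finset.sum_mul_sum]
      simp [mul_assoc, (hfg _ _).left_comm]

end Bialgebra

section HopfAlgebra

variable [Semiring C] [HopfAlgebra R C]

local notation "𝑺" => HopfAlgebra.antipode R (A := C)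

lemma comul_antipode (c : C) :
    comul (R := R) (𝑺 c) = TensorProduct.map 𝑺 𝑺 (TensorProduct.comm R C C (comul c)) := by
  let i₁ : C →ₐ[R] C ⊗[R] C := Algebra.TensorProduct.includeLeft
  let i₂ : C →ₐ[R] C ⊗[R] C := Algebra.TensorProduct.includeRight
  let γ : C →ₗ[R] C ⊗[R] C :=
    TensorProduct.map 𝑺 𝑺 ∘ₗ (TensorProduct.comm R C C).toLinearMap ∘ₗ comul
  have hcomul : toConv comul = toConv i₁.toLinearMap * toConv i₂.toLinearMap := by
    ext c
    rw [(ℛ R c).convMul_apply]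
    simp [i₁, i₂, (ℛ R c).eq]
  have hγ : toConv γ = toConv (i₂.toLinearMap ∘ₗ 𝑺) * toConv (i₁.toLinearMap ∘ₗ 𝑺) := by
    ext c
    rw [(ℛ R c).convMul_apply]
    simp [γ, i₁, i₂, ← (ℛ R c).eq]
  have hinv : toConv γ * toConv comul = 1 := by
    rw [hγ, hcomul, mul_assoc, ← mul_assoc (toConv (i₁.toLinearMap ∘ₗ _)), conv_antipode_mul,
      one_mul, conv_antipode_mul]
  exact (congrArg (fun φ => φ.ofConv c)
    (left_inv_eq_right_inv hinv LinearMap.comul_right_inv)).symm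

end HopfAlgebra

end Convolution

/-! ### Operators on `H ⊗ N` -/

section Operators

variable {R : Type*} [CommSemiring R] {A : Type*} [Semiring A]
  {N : Type*} [AddCommMonoid N] [Module R N]

section Algebra

variable [Algebra R A]

variable (R A N) in
/-- Left multiplication on the first factor of `A ⊗ N`. -/
def leftMulOp : A →ₐ[R] Module.End R (A ⊗[R] N) :=
  (Module.End.rTensorAlgHom R A N).comp (Algebra.lmul R A)

@[simp] lemma leftMulOp_tmul (a x : A) (n : N) : leftMulOp R A N a (x ⊗ₜ n) = (a * x) ⊗ₜ n :=
  rfl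

variable (R A N) in
/-- Right multiplication on the first factor of `A ⊗ N`. -/
def rightMulOp : A →ₐ[R] (Module.End R (A ⊗[R] N))ᵐᵒᵖ :=
  AlgHom.opComm.symm ((Module.End.rTensorAlgHom R A N).comp (Algebra.lsmul R R A))

variable (R A N) in
/-- Operators on the second factor of `A ⊗ N`. -/
def secondOp : Module.End R N →ₐ[R] Module.End R (A ⊗[R] N) :=
  Module.End.lTensorAlgHom R N A

@[simp] lemma secondOp_tmul (φ : Module.End R N) (x : A) (n : N) :
    secondOp R A N φ (x ⊗ₜ n) = x ⊗ₜ φ n :=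
  rfl

end Algebra

variable [HopfAlgebra R A]

variable (R A N) in
/-- Right multiplication by `S(a)` on the first factor of `A ⊗ N`. -/
def antipodeMulOp : A →ₐ[R] Module.End R (A ⊗[R] N) :=
  (AlgHom.opComm (rightMulOp R A N)).comp (HopfAlgebra.antipodeAlgHomOp R A)

@[simp] lemma antipodeMulOp_tmul (a x : A) (n : N) :
    antipodeMulOp R A N a (x ⊗ₜ n) = (x * HopfAlgebra.antipode R a) ⊗ₜ n :=
  rfl

lemma leftMulOp_commute_antipodeMulOp (a b : A) :
    Commute (leftMulOp R A N a) (antipodeMulOp R A N b) :=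
  TensorProduct.ext' fun x n => by simp [mul_assoc]

lemma secondOp_commute_antipodeMulOp (φ : Module.End R N) (b : A) :
    Commute (secondOp R A N φ) (antipodeMulOp R A N b) :=
  TensorProduct.ext' fun x n => by simp

lemma leftMulOp_commute_secondOp (a : A) (φ : Module.End R N) :
    Commute (leftMulOp R A N a) (secondOp R A N φ) :=
  TensorProduct.ext' fun x n => by simp

end Operators

namespace ActionCoaction

variable (S : ActionCoaction k H V)

/-! ### `Y(V)` is a Yetter–Drinfeld module -/

/-- The diagonal action `h ▷ (x ⊗ v) = h₁ x ⊗ h₂ ▷ v` of `H` on `H ⊗ V`, as an element of the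
convolution algebra. -/
def diagAct : WithConv (H →ₗ[k] Module.End k (H ⊗[k] V)) :=
  toConv (leftMulOp k H V).toLinearMap * convPost (secondOp k H V) (toConv S.act)

lemma diagAct_commute_antipodeMulOp (g h : H) :
    Commute (S.diagAct g) (antipodeMulOp k H V h) :=
  commute_convMul (fun _ => leftMulOp_commute_antipodeMulOp _ _)
    (fun _ => secondOp_commute_antipodeMulOp _ _) g

lemma toConv_Y_act :
    toConv S.Y.act = S.diagAct * toConv (antipodeMulOp k H V).toLinearMap := by
  rw [diagAct, mul_assoc]
  ext h x v
  simp only [(ℛ k h).convMul_apply, (ℛ k _).convMul_apply, Y, comulOuterInner, ← (ℛ k h).eq,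
    LinearMap.comp_apply, map_sum, LinearMap.lTensor_tmul, ← (ℛ k _).eq, tmul_sum]
  simp [twoSidedMul, homTensorHomMap_apply, Finset.mul_sum, convPost_apply]

lemma convApply_antipode_diagAct (h : H) (y : H ⊗[k] V) :
    convApply (LinearMap.applyₗ y ∘ₗ S.diagAct.ofConv)
      (toConv ((rightMulOp k H V).toLinearMap ∘ₗ HopfAlgebra.antipode k)) h = S.Y.act h y := by
  have hact := congrArg (fun φ => φ.ofConv h y) S.toConv_Y_act
  refine Eq.trans ?_ hact.symm
  rw [convApply_apply _ _ (ℛ k h), (ℛ k h).convMul_apply, LinearMap.sum_apply]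
  refine Finset.sum_congr rfl fun i _ => ?_
  exact LinearMap.congr_fun (S.diagAct_commute_antipodeMulOp _ _).eq.symm y

lemma compatLeft_comul (x : V) (h : H) : S.compatLeft x (comul h) =
    convApply (S.coact ∘ₗ S.act.flip x) (toConv (rightMulOp k H V).toLinearMap) h := by
  rw [convApply_apply _ _ (ℛ k h), ← (ℛ k h).eq, map_sum]
  rfl

lemma compatRight_comul (x : V) (h : H) :
    S.compatRight x (comul h) = S.diagAct h (S.coact x) := by
  rw [diagAct, (ℛ k h).convMul_apply, LinearMap.sum_apply, ← (ℛ k h).eq, map_sum]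
  refine Finset.sum_congr rfl fun i _ => ?_
  rw [compatRight, lift.tmul, LinearMap.mk₂_apply]
  induction S.coact x with
  | zero => simp
  | tmul y v => simp [convPost_apply]
  | add s t hs ht => simp only [map_add, hs, ht]

/-- Multiplying the quasi-Yetter–Drinfeld condition on the right by `S(h₃)` turns it into
`H`-linearity of `δ : V → Y(V)`. -/
lemma compat_iff_coact_act (x : V) :
    (∀ h : H, S.compatLeft x (comul (R := k) h) = S.compatRight x (comul (R := k) h)) ↔
      ∀ h, S.coact (S.act h x) = S.Y.act h (S.coact x) := by
  have hiff := convApply_eq_iff (φ := S.coact ∘ₗ S.act.flip x)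
    (ψ := LinearMap.applyₗ (S.coact x) ∘ₗ S.diagAct.ofConv)
    (conv_mul_antipode (rightMulOp k H V)) (conv_antipode_mul (rightMulOp k H V))
  simp only [LinearMap.ext_iff, ← compatLeft_comul, convApply_antipode_diagAct] at hiff
  simp only [compatRight_comul]
  exact hiff

lemma IsQuasiYD.coact_act {S : ActionCoaction k H V} (hS : S.IsQuasiYD) (h : H) (x : V) :
    S.coact (S.act h x) = S.Y.act h (S.coact x) :=
  (S.compat_iff_coact_act x).1 (fun h => hS.compat h x) h

/-- The action of `H` on `Y(V)` as an algebra map. -/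
def YActHom (hS : S.IsQuasiYD) : H →ₐ[k] Module.End k (H ⊗[k] V) :=
  convHom
    (convHom (leftMulOp k H V)
      ((secondOp k H V).comp (AlgHom.ofLinearMap S.act hS.act_one hS.act_mul))
      fun _ _ => leftMulOp_commute_secondOp _ _)
    (antipodeMulOp k H V) S.diagAct_commute_antipodeMulOp

lemma YActHom_apply (hS : S.IsQuasiYD) (h : H) : S.YActHom hS h = S.Y.act h :=
  (congrArg (fun φ => φ.ofConv h) S.toConv_Y_act).symm

lemma Y_coact_tmul (x : H) (v : V) {ι : Type*} (r : Repr k x ι) :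
    S.Y.coact (x ⊗ₜ v) = ∑ i ∈ r.index, r.left i ⊗ₜ (r.right i ⊗ₜ v) := by
  simp [Y, ← r.eq, sum_tmul]

lemma Y_coact_leftMulOp (h : H) (y : H ⊗[k] V) :
    S.Y.coact (leftMulOp k H V h y) = (toConv (leftMulOp k H (H ⊗[k] V)).toLinearMap *
      convPost (secondOp k H (H ⊗[k] V)) (toConv (leftMulOp k H V).toLinearMap)) h
        (S.Y.coact y) := by
  induction y with
  | zero => simp
  | tmul x v =>
    have hY : S.Y.coact ((h * x) ⊗ₜ v) = ∑ i ∈ (ℛ k h).index, ∑ j ∈ (ℛ k x).index,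
        ((ℛ k h).left i * (ℛ k x).left j) ⊗ₜ (((ℛ k h).right i * (ℛ k x).right j) ⊗ₜ[k] v) := by
      simp only [Y, LinearMap.comp_apply, LinearMap.rTensor_tmul, Bialgebra.comul_mul,
        ← (ℛ k x).eq, ← (ℛ k h).eq, Finset.sum_mul_sum, sum_tmul, map_sum,
        Algebra.TensorProduct.tmul_mul_tmul, LinearEquiv.coe_coe, TensorProduct.assoc_tmul]
    rw [leftMulOp_tmul, hY, S.Y_coact_tmul x v (ℛ k x), (ℛ k h).convMul_apply]
    simp only [convPost_apply, map_sum, LinearMap.sum_apply, Module.End.mul_apply, secondOp_tmul,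
      leftMulOp_tmul, AlgHom.toLinearMap_apply]
    exact Finset.sum_comm
  | add s t hs ht => simp only [map_add, hs, ht]

lemma Y_coact_secondOp (φ : Module.End k V) (y : H ⊗[k] V) :
    S.Y.coact (secondOp k H V φ y) =
      secondOp k H (H ⊗[k] V) (secondOp k H V φ) (S.Y.coact y) := by
  induction y with
  | zero => simp
  | tmul x v =>
    rw [S.Y_coact_tmul x v (ℛ k x), secondOp_tmul, S.Y_coact_tmul _ _ (ℛ k x)]
    simp
  | add s t hs ht => simp only [map_add, hs, ht]

lemma Y_coact_antipodeMulOp (h : H) (y : H ⊗[k] V) :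
    S.Y.coact (antipodeMulOp k H V h y) =
      (convPost (secondOp k H (H ⊗[k] V)) (toConv (antipodeMulOp k H V).toLinearMap) *
        toConv (antipodeMulOp k H (H ⊗[k] V)).toLinearMap) h (S.Y.coact y) := by
  induction y with
  | zero => simp
  | tmul x v =>
    have hY : S.Y.coact ((x * HopfAlgebra.antipode k h) ⊗ₜ v) =
        ∑ i ∈ (ℛ k h).index, ∑ j ∈ (ℛ k x).index,
          ((ℛ k x).left j * HopfAlgebra.antipode k ((ℛ k h).right i)) ⊗ₜ
            (((ℛ k x).right j * HopfAlgebra.antipode k ((ℛ k h).left i)) ⊗ₜ[k] v) := by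
      simp only [Y, LinearMap.comp_apply, LinearMap.rTensor_tmul, Bialgebra.comul_mul,
        comul_antipode, ← (ℛ k x).eq, ← (ℛ k h).eq, Finset.sum_mul_sum, sum_tmul, map_sum,
        TensorProduct.comm_tmul, TensorProduct.map_tmul,
        Algebra.TensorProduct.tmul_mul_tmul, LinearEquiv.coe_coe, TensorProduct.assoc_tmul]
      exact Finset.sum_comm
    rw [antipodeMulOp_tmul, hY, S.Y_coact_tmul x v (ℛ k x), (ℛ k h).convMul_apply]
    simp only [convPost_apply, map_sum, LinearMap.sum_apply, Module.End.mul_apply, secondOp_tmul,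
      antipodeMulOp_tmul, AlgHom.toLinearMap_apply]
    exact Finset.sum_comm
  | add s t hs ht => simp only [map_add, hs, ht]

lemma Y_coact_act (h : H) (y : H ⊗[k] V) :
    S.Y.coact (S.Y.act h y) = S.Y.Y.act h (S.Y.coact y) := by
  have hconv := convMul_intertwine S.Y.coact
    (convMul_intertwine S.Y.coact (φ := toConv (leftMulOp k H V).toLinearMap)
      (ψ := convPost (secondOp k H V) (toConv S.act)) (φ' := _)
      (ψ' := convPost (secondOp k H _) (convPost (secondOp k H V) (toConv S.act)))
      S.Y_coact_leftMulOp fun h => S.Y_coact_secondOp (S.act h))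
    (ψ := toConv (antipodeMulOp k H V).toLinearMap) S.Y_coact_antipodeMulOp h y
  have hYY : toConv S.Y.Y.act = toConv (leftMulOp k H (H ⊗[k] V)).toLinearMap *
      convPost (secondOp k H (H ⊗[k] V)) (toConv (leftMulOp k H V).toLinearMap) *
      convPost (secondOp k H (H ⊗[k] V)) (convPost (secondOp k H V) (toConv S.act)) *
      (convPost (secondOp k H (H ⊗[k] V)) (toConv (antipodeMulOp k H V).toLinearMap) *
        toConv (antipodeMulOp k H (H ⊗[k] V)).toLinearMap) := by
    rw [S.Y.toConv_Y_act, diagAct, S.toConv_Y_act, diagAct, map_mul, map_mul]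
    simp only [mul_assoc]
  rw [← diagAct, ← toConv_Y_act, ← hYY] at hconv
  exact hconv

lemma Y_coassoc (y : H ⊗[k] V) :
    TensorProduct.assoc k H H (H ⊗[k] V) ((comul (R := k) (A := H)).rTensor _ (S.Y.coact y)) =
      S.Y.coact.lTensor H (S.Y.coact y) := by
  induction y with
  | zero => simp
  | tmul x v =>
    have hcoassoc := congrArg (((TensorProduct.mk k H V).flip v).lTensor H |>.lTensor H)
      (sum_tmul_tmul_eq (ℛ k x) (fun i => ℛ k _) (fun i => ℛ k _))
    simp only [map_sum, LinearMap.lTensor_tmul, LinearMap.flip_apply, TensorProduct.mk_apply]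
      at hcoassoc
    rw [S.Y_coact_tmul x v (ℛ k x)]
    simp only [map_sum, LinearMap.lTensor_tmul, S.Y_coact_tmul _ _ (ℛ k _),
      LinearMap.rTensor_tmul, ← (ℛ k ((ℛ k x).left _)).eq, sum_tmul, tmul_sum,
      TensorProduct.assoc_tmul]
    exact hcoassoc
  | add s t hs ht => simp only [map_add, hs, ht]

lemma Y_counit (y : H ⊗[k] V) :
    TensorProduct.lid k (H ⊗[k] V) ((counit (R := k) (A := H)).rTensor _ (S.Y.coact y)) = y := by
  induction y with
  | zero => simp
  | tmul x v =>
    rw [S.Y_coact_tmul x v (ℛ k x)]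
    simp only [map_sum, LinearMap.rTensor_tmul, TensorProduct.lid_tmul, smul_tmul', ← sum_tmul,
      sum_counit_smul]
  | add s t hs ht => simp only [map_add, hs, ht]

theorem isYD_Y (hS : S.IsQuasiYD) : S.Y.IsYD where
  act_one := by rw [← S.YActHom_apply hS, map_one]
  act_mul g h := by simp only [← S.YActHom_apply hS, map_mul]
  compat h y := (S.Y.compat_iff_coact_act y).2 (fun h => S.Y_coact_act h y) h
  coassoc := S.Y_coassoc
  counit := S.Y_counit

/-! ### `V` is a perfect subquotient of `Y(V)` -/

@[simp] lemma counitTensor_tmul (x : H) (v : V) :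
    counitTensor k H V (x ⊗ₜ v) = counit (R := k) x • v := by
  simp [counitTensor]

lemma counitTensor_leftMulOp (h : H) (y : H ⊗[k] V) :
    counitTensor k H V (leftMulOp k H V h y) = counit (R := k) h • counitTensor k H V y := by
  induction y with
  | zero => simp
  | tmul x v => simp [mul_smul]
  | add s t hs ht => simp only [map_add, smul_add, hs, ht]

lemma counitTensor_antipodeMulOp (h : H) (y : H ⊗[k] V) :
    counitTensor k H V (antipodeMulOp k H V h y) = counit (R := k) h • counitTensor k H V y := by
  induction y with
  | zero => simp
  | tmul x v => simp [mul_smul, smul_comm (counit (R := k) x)]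
  | add s t hs ht => simp only [map_add, smul_add, hs, ht]

lemma counitTensor_secondOp (φ : Module.End k V) (y : H ⊗[k] V) :
    counitTensor k H V (secondOp k H V φ y) = φ (counitTensor k H V y) := by
  induction y with
  | zero => simp
  | tmul x v => simp
  | add s t hs ht => simp only [map_add, hs, ht]

lemma counitTensor_act (h : H) (y : H ⊗[k] V) :
    counitTensor k H V (S.Y.act h y) = S.act h (counitTensor k H V y) := by
  have hconv := convMul_intertwine (counitTensor k H V)
    (convMul_intertwine (counitTensor k H V) (φ := toConv (leftMulOp k H V).toLinearMap)
      (ψ := convPost (secondOp k H V) (toConv S.act)) (φ' := 1) (ψ' := toConv S.act)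
      (fun h y => by simp [counitTensor_leftMulOp, Algebra.algebraMap_eq_smul_one])
      fun h => counitTensor_secondOp (S.act h))
    (ψ := toConv (antipodeMulOp k H V).toLinearMap) (ψ' := 1)
    (fun h y => by simp [counitTensor_antipodeMulOp, Algebra.algebraMap_eq_smul_one]) h y
  rwa [← diagAct, ← toConv_Y_act, one_mul, mul_one] at hconv

lemma lTensor_counitTensor_Y_coact (y : H ⊗[k] V) :
    (counitTensor k H V).lTensor H (S.Y.coact y) = y := by
  induction y with
  | zero => simp
  | tmul x v =>
    rw [S.Y_coact_tmul x v (ℛ k x)]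
    simp only [map_sum, LinearMap.lTensor_tmul, counitTensor_tmul, ← smul_tmul, ← sum_tmul,
      sum_smul_counit]
  | add s t hs ht => simp only [map_add, hs, ht]

theorem isPerfectSubquotient_Y (hS : S.IsQuasiYD) :
    IsPerfectSubquotient S S.Y S.coact (counitTensor k H V) := by
  have hsub : IsSubquotient S S.Y S.coact (counitTensor k H V) :=
    { map_act_left := hS.coact_act
      map_act_right := S.counitTensor_act
      coact_eq := LinearMap.ext fun x => (S.lTensor_counitTensor_Y_coact _).symm }
  exact hsub.isPerfectSubquotient hS (S.isYD_Y hS).toIsQuasiYD LinearMap.id fun x => by simp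

end ActionCoaction

/-! ### Finite-dimensional coideals -/

section Coideals

lemma rightHit_rightHit {R C : Type*} [CommSemiring R] [AddCommMonoid C] [Module R C]
    [Coalgebra R C] (φ ψ : C →ₗ[R] R) (c : C) :
    rightHit ψ (rightHit φ c) = rightHit (toConv ψ * toConv φ).ofConv c := by
  have hcoassoc := congrArg ((TensorProduct.rid R C).toLinearMap ∘ₗ
    (LinearMap.mul' R R ∘ₗ TensorProduct.map ψ φ).lTensor C)
    (sum_tmul_tmul_eq (ℛ R c) (fun i => ℛ R _) (fun i => ℛ R _))
  simp only [map_sum, LinearMap.comp_apply, LinearMap.lTensor_tmul, TensorProduct.map_tmul,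
    LinearMap.mul'_apply, LinearEquiv.coe_coe, TensorProduct.rid_tmul] at hcoassoc
  rw [rightHit_apply φ (ℛ R c), rightHit_apply _ (ℛ R c)]
  simp only [map_sum, map_smul]
  simp only [rightHit_apply ψ (ℛ R _), (ℛ R _).convMul_apply, Finset.smul_sum, Finset.sum_smul,
    smul_smul, mul_comm (φ _)]
  exact hcoassoc

variable {D : Type*} [AddCommGroup D] [Module k D] [Coalgebra k D]

lemma finiteDimensional_range_rightHit (c : D) :
    FiniteDimensional k (LinearMap.range (rightHit (R := k).flip c)) := by
  have hle : LinearMap.range (rightHit (R := k).flip c) ≤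
      Submodule.span k ((ℛ k c).left '' (ℛ k c).index) := by
    rintro _ ⟨φ, rfl⟩
    rw [LinearMap.flip_apply, rightHit_apply φ (ℛ k c)]
    exact Submodule.sum_mem _ fun i hi =>
      Submodule.smul_mem _ _ (Submodule.subset_span ⟨i, hi, rfl⟩)
  have := FiniteDimensional.span_of_finite k ((ℛ k c).index.finite_toSet.image (ℛ k c).left)
  exact Submodule.finiteDimensional_of_le hle

lemma comul_mem_range_rTensor {C : Submodule k D} {c : D} (hc : ∀ φ : D →ₗ[k] k, rightHit φ c ∈ C) :
    comul c ∈ LinearMap.range (C.subtype.rTensor D) := by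
  let e := Module.Basis.ofVectorSpace k D
  obtain ⟨F, hF⟩ := (eventually_eq_sum_coord e (comul (R := k) c)).exists
  rw [hF]
  exact Submodule.sum_mem _ fun j _ => ⟨⟨_, hc (e.coord j)⟩ ⊗ₜ e j, rfl⟩

/-- The coideal is spanned by the elements `x₁ φ(x₂)` with `x ∈ F`. -/
lemma exists_finiteDimensional_coideal (F : Submodule k D) [FiniteDimensional k F] :
    ∃ C : Submodule k D, FiniteDimensional k C ∧ F ≤ C ∧
      ∀ c ∈ C, comul c ∈ LinearMap.range (C.subtype.rTensor D) := by
  obtain ⟨s, rfl⟩ := Submodule.fg_iff_finiteDimensional F |>.2 ‹_›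
  let C := ⨆ x : s, LinearMap.range (rightHit (R := k).flip (x : D))
  refine ⟨C, ?_, Submodule.span_le.2 fun x hx => ?_,
    fun c hc => comul_mem_range_rTensor fun ψ => ?_⟩
  · have := fun x : D => finiteDimensional_range_rightHit (k := k) x
    infer_instance
  · refine Submodule.mem_iSup_of_mem ⟨x, hx⟩ ⟨counit, ?_⟩
    rw [LinearMap.flip_apply, rightHit_apply _ (ℛ k x), sum_smul_counit]
  · suffices hle : C ≤ C.comap (rightHit ψ) from hle hc
    refine iSup_le fun x => ?_
    rintro _ ⟨φ, rfl⟩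
    exact Submodule.mem_iSup_of_mem x ⟨_, (rightHit_rightHit φ ψ _).symm⟩

lemma exists_finiteDimensional_coideal_projection [IsCocomm k D] (F : Submodule k D)
    [FiniteDimensional k F] : ∃ (C : Submodule k D) (p : D →ₗ[k] C),
      FiniteDimensional k C ∧ F ≤ C ∧ p ∘ₗ C.subtype = LinearMap.id ∧
        ∀ c ∈ C, (C.subtype ∘ₗ p).lTensor D (comul (R := k) c) = comul c := by
  obtain ⟨C, hfin, hF, hC⟩ := exists_finiteDimensional_coideal F
  obtain ⟨p, hp⟩ := LinearMap.exists_leftInverse_of_injective C.subtype C.ker_subtype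
  refine ⟨C, p, hfin, hF, hp, fun c hc => ?_⟩
  obtain ⟨t, ht⟩ := hC c hc
  rw [← comm_comul, ← ht, LinearMap.lTensor_comm, ← LinearMap.comp_apply (LinearMap.rTensor D _),
    ← LinearMap.rTensor_comp, LinearMap.comp_assoc, hp, LinearMap.comp_id]

end Coideals

lemma convMul_comm_of_commute {R C E : Type*} [CommSemiring R] [AddCommMonoid C] [Module R C]
    [Coalgebra R C] [IsCocomm R C] [Semiring E] [Algebra R E] {φ ψ : WithConv (C →ₗ[R] E)}
    (hφψ : ∀ c d, Commute (φ c) (ψ d)) : φ * ψ = ψ * φ := by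
  ext c
  have hswap := congrArg (LinearMap.mul' R E ∘ₗ TensorProduct.map φ.ofConv ψ.ofConv)
    (comm_comul R c)
  rw [← (ℛ R c).eq] at hswap
  simp only [map_sum, LinearMap.comp_apply, TensorProduct.comm_tmul, TensorProduct.map_tmul,
    LinearMap.mul'_apply] at hswap
  rw [(ℛ R c).convMul_apply, (ℛ R c).convMul_apply]
  exact hswap.symm.trans (Finset.sum_congr rfl fun i _ => (hφψ _ _).eq)

/-! ### Yetter–Drinfeld submodules of `Y(V)` -/

section LTensor

variable {R A N N' : Type*} [CommSemiring R] [AddCommMonoid N] [Module R N] [AddCommMonoid N']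
  [Module R N'] (j : N →ₗ[R] N')

lemma lTensor_leftMulOp [Semiring A] [Algebra R A] (a : A) (y : A ⊗[R] N) :
    j.lTensor A (leftMulOp R A N a y) = leftMulOp R A N' a (j.lTensor A y) := by
  induction y with
  | zero => simp
  | tmul x v => simp
  | add s t hs ht => simp only [map_add, hs, ht]

lemma lTensor_antipodeMulOp [Semiring A] [HopfAlgebra R A] (a : A) (y : A ⊗[R] N) :
    j.lTensor A (antipodeMulOp R A N a y) = antipodeMulOp R A N' a (j.lTensor A y) := by
  induction y with
  | zero => simp
  | tmul x v => simp
  | add s t hs ht => simp only [map_add, hs, ht]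

variable {j} in
lemma lTensor_secondOp [Semiring A] [Algebra R A] {φ : Module.End R N} {ψ : Module.End R N'}
    (hj : ∀ v, j (φ v) = ψ (j v)) (y : A ⊗[R] N) :
    j.lTensor A (secondOp R A N φ y) = secondOp R A N' ψ (j.lTensor A y) := by
  induction y with
  | zero => simp
  | tmul x v => simp [hj]
  | add s t hs ht => simp only [map_add, hs, ht]

end LTensor

namespace ActionCoaction

section Injective

variable {S : ActionCoaction k H V} {T : ActionCoaction k H W} {j : V →ₗ[k] W}

lemma lTensor_Y_act (hact : ∀ h x, j (S.act h x) = T.act h (j x)) (h : H) (y : H ⊗[k] V) :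
    j.lTensor H (S.Y.act h y) = T.Y.act h (j.lTensor H y) := by
  have hconv := convMul_intertwine (j.lTensor H)
    (convMul_intertwine (j.lTensor H) (φ := toConv (leftMulOp k H V).toLinearMap)
      (ψ := convPost (secondOp k H V) (toConv S.act))
      (φ' := toConv (leftMulOp k H W).toLinearMap)
      (ψ' := convPost (secondOp k H W) (toConv T.act))
      (lTensor_leftMulOp j) fun h => lTensor_secondOp (hact h))
    (ψ := toConv (antipodeMulOp k H V).toLinearMap)
    (ψ' := toConv (antipodeMulOp k H W).toLinearMap) (lTensor_antipodeMulOp j) h y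
  rwa [← diagAct, ← diagAct, ← toConv_Y_act, ← toConv_Y_act] at hconv

variable (S T j) in
lemma lTensor_Y_coact (y : H ⊗[k] V) :
    (j.lTensor H).lTensor H (S.Y.coact y) = T.Y.coact (j.lTensor H y) := by
  induction y with
  | zero => simp
  | tmul x v =>
    rw [S.Y_coact_tmul x v (ℛ k x), LinearMap.lTensor_tmul, T.Y_coact_tmul _ _ (ℛ k x)]
    simp
  | add s t hs ht => simp only [map_add, hs, ht]

lemma IsYD.of_injective (hT : T.IsYD) (hj : Function.Injective j)
    (hact : ∀ h x, j (S.act h x) = T.act h (j x))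
    (hcoact : ∀ x, j.lTensor H (S.coact x) = T.coact (j x)) : S.IsYD where
  act_one := LinearMap.ext fun x => hj <| by simp [hact, hT.act_one]
  act_mul g h := LinearMap.ext fun x => hj <| by simp [hact, hT.act_mul]
  compat h x := (S.compat_iff_coact_act x).2 (fun h => by
    apply Module.Flat.lTensor_preserves_injective_linearMap (M := H) j hj
    rw [hcoact, hact, hT.coact_act, lTensor_Y_act hact, hcoact]) h
  coassoc x := by
    apply Module.Flat.lTensor_preserves_injective_linearMap (M := H) _
      (Module.Flat.lTensor_preserves_injective_linearMap (M := H) j hj)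
    calc (j.lTensor H).lTensor H (S.Y.coact (S.coact x))
      _ = T.Y.coact (T.coact (j x)) := by rw [lTensor_Y_coact S T, hcoact]
      _ = T.coact.lTensor H (j.lTensor H (S.coact x)) := by rw [hcoact]; exact hT.coassoc (j x)
      _ = (j.lTensor H).lTensor H (S.coact.lTensor H (S.coact x)) := by
        rw [← LinearMap.lTensor_comp_apply, ← LinearMap.lTensor_comp_apply]
        have hcomp : T.coact ∘ₗ j = j.lTensor H ∘ₗ S.coact :=
          LinearMap.ext fun x => (hcoact x).symm
        rw [hcomp]
  counit x := hj <| by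
    have hcounit (y : H ⊗[k] V) :
        j (counitTensor k H V y) = counitTensor k H W (j.lTensor H y) := by
      induction y with
      | zero => simp
      | tmul x v => simp
      | add s t hs ht => simp only [map_add, hs, ht]
    rw [← hT.counit (j x), ← hcoact]
    exact hcounit (S.coact x)

end Injective

lemma isPerfectSubquotient_of_injective {S : ActionCoaction k H V} (hS : S.IsQuasiYD)
    {T : ActionCoaction k H W} (hT : T.IsQuasiYD) {j : W →ₗ[k] H ⊗[k] V} {π : H ⊗[k] V →ₗ[k] W}
    (hπ : π ∘ₗ j = LinearMap.id) (hδ : ∀ x, j (π (S.coact x)) = S.coact x)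
    (hact : ∀ h y, j (T.act h y) = S.Y.act h (j y))
    (hcoact : ∀ y, j.lTensor H (T.coact y) = S.Y.coact (j y)) :
    IsPerfectSubquotient S T (π ∘ₗ S.coact) (counitTensor k H V ∘ₗ j) := by
  have hj : Function.Injective j := Function.LeftInverse.injective (LinearMap.congr_fun hπ)
  have hcoactδ (x : V) : j.lTensor H (T.coact (π (S.coact x))) = S.Y.coact (S.coact x) := by
    rw [hcoact, hδ]
  have hsub : IsSubquotient S T (π ∘ₗ S.coact) (counitTensor k H V ∘ₗ j) :=
    { map_act_left := fun h x => hj <| by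
        rw [LinearMap.comp_apply, LinearMap.comp_apply, hδ, hact, hδ, hS.coact_act]
      map_act_right := fun h y => by
        simp only [LinearMap.comp_apply, hact, counitTensor_act]
      coact_eq := LinearMap.ext fun x => by
        simp only [LinearMap.lTensor_comp, LinearMap.comp_apply, hcoactδ,
          lTensor_counitTensor_Y_coact] }
  refine hsub.isPerfectSubquotient hS hT π fun x => ?_
  rw [← hcoactδ, ← LinearMap.lTensor_comp_apply, hπ, LinearMap.lTensor_id]
  rfl

/-! ### Commutative cocommutative Hopf algebras -/

variable (S : ActionCoaction k H V)

lemma Y_act_of_comm (hH : ∀ a b : H, a * b = b * a) [IsCocomm k H] (h : H) :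
    S.Y.act h = secondOp k H V (S.act h) := by
  have hantipode : toConv (antipodeMulOp k H V).toLinearMap =
      toConv ((leftMulOp k H V).toLinearMap ∘ₗ HopfAlgebra.antipode k) := by
    ext h x v
    simp [hH x]
  have hcomm : convPost (secondOp k H V) (toConv S.act) *
      toConv (antipodeMulOp k H V).toLinearMap =
        toConv (antipodeMulOp k H V).toLinearMap * convPost (secondOp k H V) (toConv S.act) :=
    convMul_comm_of_commute fun _ _ => secondOp_commute_antipodeMulOp _ _
  have hact : toConv S.Y.act = convPost (secondOp k H V) (toConv S.act) := by
    rw [toConv_Y_act, diagAct, mul_assoc, hcomm, hantipode, ← mul_assoc, conv_mul_antipode, one_mul]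
  exact congrArg (fun φ => φ.ofConv h) hact

/-- The action on the second factor of `C ⊗ V` together with `c ⊗ v ↦ c₁ ⊗ (p(c₂) ⊗ v)`. For `H`
commutative and cocommutative and `p` a projection onto a coideal `C`, this is the restriction of
the structure of `Y(V)`. -/
def coidealY {C : Submodule k H} (p : H →ₗ[k] C) : ActionCoaction k H (C ⊗[k] V) where
  act := LinearMap.lTensorHom C ∘ₗ S.act
  coact := (TensorProduct.assoc k H C V).toLinearMap ∘ₗ
    (p.lTensor H ∘ₗ comul ∘ₗ C.subtype).rTensor V

section CoidealY

variable {C : Submodule k H} {p : H →ₗ[k] C}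

lemma rTensor_subtype_coidealY_act (hH : ∀ a b : H, a * b = b * a) [IsCocomm k H] (h : H)
    (y : C ⊗[k] V) :
    C.subtype.rTensor V ((S.coidealY p).act h y) = S.Y.act h (C.subtype.rTensor V y) := by
  induction y with
  | zero => simp
  | tmul c v => simp [coidealY, Y_act_of_comm S hH]
  | add s t hs ht => simp only [map_add, hs, ht]

lemma lTensor_subtype_coidealY_coact
    (hp : ∀ c ∈ C, (C.subtype ∘ₗ p).lTensor H (comul (R := k) c) = comul c) (y : C ⊗[k] V) :
    (C.subtype.rTensor V).lTensor H ((S.coidealY p).coact y) =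
      S.Y.coact (C.subtype.rTensor V y) := by
  induction y with
  | zero => simp
  | tmul c v =>
    rw [LinearMap.rTensor_tmul, Y, LinearMap.comp_apply, LinearMap.rTensor_tmul, C.subtype_apply,
      ← hp c c.2, ← (ℛ k (c : H)).eq]
    simp [coidealY, ← (ℛ k (c : H)).eq, sum_tmul]
  | add s t hs ht => simp only [map_add, hs, ht]

end CoidealY

theorem exists_isPerfectSubquotient_of_comm (hS : S.IsQuasiYD) [FiniteDimensional k V]
    (hH : ∀ a b : H, a * b = b * a) [IsCocomm k H] :
    ∃ C : Submodule k H, FiniteDimensional k C ∧ ∃ T : ActionCoaction k H (C ⊗[k] V), T.IsYD ∧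
      ∃ (μ : V →ₗ[k] C ⊗[k] V) (ν : C ⊗[k] V →ₗ[k] V), IsPerfectSubquotient S T μ ν := by
  obtain ⟨F, hF, hδF⟩ := TensorProduct.exists_finite_submodule_left_of_setFinite _
    (Set.finite_range (S.coact ∘ Module.finBasis k V))
  obtain ⟨C, p, hC, hFC, hp, hcomul⟩ := exists_finiteDimensional_coideal_projection F
  let j : C ⊗[k] V →ₗ[k] H ⊗[k] V := C.subtype.rTensor V
  have hpj : p.rTensor V ∘ₗ j = LinearMap.id := by
    rw [← LinearMap.rTensor_comp, hp, LinearMap.rTensor_id]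
  have hδ : j ∘ₗ p.rTensor V ∘ₗ S.coact = S.coact := by
    refine (Module.finBasis k V).ext fun i => ?_
    obtain ⟨t, ht⟩ := hδF ⟨i, rfl⟩
    have hpF : (C.subtype ∘ₗ p) ∘ₗ F.subtype = F.subtype := LinearMap.ext fun x =>
      congrArg Subtype.val (LinearMap.congr_fun hp ⟨x, hFC x.2⟩)
    rw [LinearMap.comp_apply, LinearMap.comp_apply, ← Function.comp_apply (f := S.coact), ← ht,
      ← LinearMap.rTensor_comp_apply, ← LinearMap.rTensor_comp_apply, hpF]
  have hact := S.rTensor_subtype_coidealY_act (p := p) hH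
  have hcoact := S.lTensor_subtype_coidealY_coact hcomul
  have hj : Function.Injective j := Function.LeftInverse.injective (LinearMap.congr_fun hpj)
  have hT : (S.coidealY p).IsYD := (S.isYD_Y hS).of_injective hj hact hcoact
  exact ⟨C, hC, _, hT, _, _, isPerfectSubquotient_of_injective hS hT.toIsQuasiYD hpj
    (LinearMap.congr_fun hδ) hact hcoact⟩

end ActionCoaction

end BraidedDoubles

end

theorem theoremF {k : Type u} {H : Type v} {V : Type w} [Field k] [Ring H]
    [HopfAlgebra k H] [AddCommGroup V] [Module k V]
    (S : BraidedDoubles.ActionCoaction k H V) (hS : S.IsQuasiYD) :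
    (S.Y.IsYD ∧
      BraidedDoubles.IsPerfectSubquotient S S.Y S.coact (BraidedDoubles.counitTensor k H V)) ∧
    (FiniteDimensional k V →
      (FiniteDimensional k H ∨ ((∀ a b : H, a * b = b * a) ∧ Coalgebra.IsCocomm k H)) →
      ∃ (Y : Type (max v w)) (_ : AddCommGroup Y) (_ : Module k Y)
        (T : BraidedDoubles.ActionCoaction k H Y),
        FiniteDimensional k Y ∧ T.IsYD ∧
          ∃ (μ : V →ₗ[k] Y) (ν : Y →ₗ[k] V), BraidedDoubles.IsPerfectSubquotient S T μ ν) := by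
  refine ⟨⟨S.isYD_Y hS, S.isPerfectSubquotient_Y hS⟩, fun hV hH => ?_⟩
  rcases hH with hH | ⟨hcomm, hcocomm⟩
  · exact ⟨H ⊗[k] V, inferInstance, inferInstance, S.Y, inferInstance, S.isYD_Y hS, _, _,
      S.isPerfectSubquotient_Y hS⟩
  · obtain ⟨C, hC, T, hT, μ, ν, h⟩ := S.exists_isPerfectSubquotient_of_comm hS hcomm
    exact ⟨C ⊗[k] V, inferInstance, inferInstance, T, inferInstance, hT, μ, ν, h⟩
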